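/- Let $\mathcal I=(x_-,x_+)\subset\mathbb R$ be a bounded interval, $x_-<x_+$, with midpoint $y=\frac{x_-+x_+}{2}$, and let $\alpha\in\mathbb R$. For $\beta_-,\beta_+\in\mathbb R$ consider in the complex Hilbert space $L^2(\mathcal I)$ the densely defined sesquilinear forms $$\mathfrak h^D_{\mathcal I,\alpha}[u,v]=(u',v')_{L^2(\mathcal I)}+\alpha\,u(y)\overline{v(y)},\qquad \operatorname{dom}\mathfrak h^D_{\mathcal I,\alpha}=W^{1,2}_0(\mathcal I),$$ $$\mathfrak h^R_{\mathcal I,\alpha,\beta_-,\beta_+}[u,v]=(u',v')_{L^2(\mathcal I)}+\alpha\,u(y)\overline{v(y)}+\tfrac12\bigl(\beta_-u(x_-)\overline{v(x_-)}+\beta_+u(x_+)\overline{v(x_+)}\bigr),\qquad \operatorname{dom}\mathfrak h^R_{\mathcal I,\alpha,\beta_-,\beta_+}=W^{1,2}(\mathcal I),$$ where point values are those of the continuous representative on $\overline{\mathcal I}$. Let $H^D_{\mathcal I,\alpha}$ and $H^R_{\mathcal I,\alpha,\beta_-,\beta_+}$ be the operators associated with these forms: for a form $\mathfrak h$ the associated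 operator $H$ has as its domain all $u\in\operatorname{dom}\mathfrak h$ for which there is $f\in L^2(\mathcal I)$ with $\mathfrak h[u,v]=(f,v)_{L^2(\mathcal I)}$ for all $v\in\operatorname{dom}\mathfrak h$, and $Hu=f$. Then: 1. $H^D_{\mathcal I,\alpha}$ and, for all $\beta_-,\beta_+\in\mathbb R$, $H^R_{\mathcal I,\alpha,\beta_-,\beta_+}$ are self-adjoint, and their spectra are purely discrete (they consist of isolated eigenvalues of finite multiplicity), bounded from below and accumulate at $+\infty$. 2. Let $\lambda_j(H)$, $j=1,2,\dots$, denote the $j$-th eigenvalue of such an operator $H$, where the eigenvalues are counted with multiplicities and ordered as a nondecreasing sequence. Then for every $j\in\mathbb N$ $$\lambda_j\bigl(H^R_{\mathcal I,\alpha,\beta_-,\beta_+}\bigr)\to\lambda_j\bigl(H^D_{\mathcal I,\alpha}\bigr)\quad\text{as }\min\{\beta_-,\beta_+\}\to+\infty .$$ -/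

import Mathlib

open MeasureTheory Set Filter Topology
open scoped ContDiff

/-! ### Unbounded operators in a Hilbert space: spectrum, eigenvalues, forms -/

namespace UnboundedOp

variable {H : Type*} [NormedAddCommGroup H] [InnerProductSpace ℂ H]

/-- The resolvent set of a partially defined operator `A`: those `z` for which `A - z` has an
everywhere defined bounded inverse `R`. -/
def resolventSet (A : H →ₗ.[ℂ] H) : Set ℂ :=
  {z | ∃ R : H →L[ℂ] H,
    (∀ f : H, ∃ hf : R f ∈ A.domain, A ⟨R f, hf⟩ - z • R f = f) ∧
    (∀ u : A.domain, R (A u - z • (u : H)) = u)}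

/-- The spectrum of a partially defined operator. -/
def spectrum (A : H →ₗ.[ℂ] H) : Set ℂ := (resolventSet A)ᶜ

/-- The eigenspace `{u ∈ dom A : A u = μ u}`. -/
def eigenspace (A : H →ₗ.[ℂ] H) (μ : ℂ) : Submodule ℂ H :=
  A.graph.comap (LinearMap.id.prod (μ • LinearMap.id))

theorem mem_eigenspace {A : H →ₗ.[ℂ] H} {μ : ℂ} {u : H} :
    u ∈ eigenspace A μ ↔ ∃ hu : u ∈ A.domain, A ⟨u, hu⟩ = μ • u := by
  simp [eigenspace, LinearPMap.mem_graph_iff]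

/-- The spectrum of `A` is purely discrete (it consists of isolated eigenvalues of finite
multiplicity), bounded from below, and accumulates at `+∞`. -/
structure HasPurelyDiscreteSpectrum (A : H →ₗ.[ℂ] H) : Prop where
  isolated : ∀ z ∈ spectrum A, ¬ AccPt z (𝓟 (spectrum A))
  isEigenvalue : ∀ z ∈ spectrum A, eigenspace A z ≠ ⊥
  finiteDimensional : ∀ z ∈ spectrum A, FiniteDimensional ℂ (eigenspace A z)
  bddBelow : BddBelow {t : ℝ | (t : ℂ) ∈ spectrum A}
  not_bddAbove : ¬ BddAbove {t : ℝ | (t : ℂ) ∈ spectrum A}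

/-- The `j`-th eigenvalue (`j = 1, 2, …`) of a self-adjoint operator with purely discrete spectrum
bounded from below, in nondecreasing order and counted with multiplicities: the least `t` such
that the eigenspaces for the eigenvalues `≤ t` span a space of dimension at least `j`. -/
noncomputable def nthEigenvalue (A : H →ₗ.[ℂ] H) (j : ℕ) : ℝ :=
  sInf {t : ℝ | (j : Cardinal) ≤
    Module.rank ℂ ↥(⨆ μ : ℝ, ⨆ _ : μ ≤ t, eigenspace A (μ : ℂ))}

variable (H) in
/-- A densely defined sesquilinear form (linear in the first, antilinear in the second argument). -/
structure DenseForm where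
  /-- the form domain -/
  domain : Submodule ℂ H
  /-- the form -/
  form : domain →ₗ[ℂ] domain →ₛₗ[starRingEnd ℂ] ℂ
  dense : Dense (domain : Set H)

namespace DenseForm

/-- The graph of the operator associated with the form `h`: all `(u, f)` with `u ∈ dom h` and
`h[u, v] = (f, v)` for all `v ∈ dom h`. -/
def opGraph (h : DenseForm H) : Submodule ℂ (H × H) where
  carrier := {p | ∃ hu : p.1 ∈ h.domain, ∀ v : h.domain,
    h.form ⟨p.1, hu⟩ v = inner ℂ (v : H) p.2}
  zero_mem' := ⟨h.domain.zero_mem, fun v => by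
    have : (⟨(0 : H × H).1, h.domain.zero_mem⟩ : h.domain) = 0 := rfl
    rw [this]; simp⟩
  add_mem' := by
    rintro ⟨u, f⟩ ⟨u', f'⟩ ⟨hu, huf⟩ ⟨hu', huf'⟩
    refine ⟨h.domain.add_mem hu hu', fun v => ?_⟩
    have : (⟨((u, f) + (u', f')).1, h.domain.add_mem hu hu'⟩ : h.domain) = ⟨u, hu⟩ + ⟨u', hu'⟩ :=
      rfl
    rw [this, map_add, LinearMap.add_apply, huf v, huf' v]
    simp
  smul_mem' := by
    rintro c ⟨u, f⟩ ⟨hu, huf⟩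
    refine ⟨h.domain.smul_mem c hu, fun v => ?_⟩
    have : (⟨(c • (u, f)).1, h.domain.smul_mem c hu⟩ : h.domain) = c • ⟨u, hu⟩ := rfl
    rw [this, map_smul, LinearMap.smul_apply, huf v]
    simp

/-- As the form is densely defined, its operator is single-valued. -/
theorem opGraph_snd_eq_zero (h : DenseForm H) (p : H × H) (hp : p ∈ h.opGraph) (h0 : p.1 = 0) :
    p.2 = 0 := by
  obtain ⟨u, f⟩ := p
  obtain ⟨hu, huf⟩ := hp
  simp only at h0
  subst h0
  refine h.dense.eq_zero_of_inner_right ℂ fun v hv => ?_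
  have h1 := huf ⟨v, hv⟩
  have : (⟨((0 : H), f).1, hu⟩ : h.domain) = 0 := rfl
  rw [this] at h1
  simpa using h1.symm

/-- The operator `A` associated with the form `h`:
`dom A ⊆ dom h` and `(A u, v) = h[u, v]` for `u ∈ dom A`, `v ∈ dom h`. -/
noncomputable def operator (h : DenseForm H) : H →ₗ.[ℂ] H := h.opGraph.toLinearPMap

theorem operator_graph (h : DenseForm H) : h.operator.graph = h.opGraph :=
  Submodule.toLinearPMap_graph_eq _ h.opGraph_snd_eq_zero

end DenseForm

end UnboundedOp

/-! ### Sobolev spaces on a bounded interval -/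

namespace IntervalSobolev

/-- The Hilbert space `L²(a, b)` of complex-valued functions. -/
abbrev L2 (a b : ℝ) : Type := Lp ℂ 2 (volume.restrict (Ioo a b))

/-- `φ ∈ C_c^∞(a, b)`. -/
structure IsTest (a b : ℝ) (φ : ℝ → ℂ) : Prop where
  contDiff : ContDiff ℝ ∞ φ
  hasCompactSupport : HasCompactSupport φ
  tsupport_subset : tsupport φ ⊆ Ioo a b

/-- `g` is the weak derivative of `u` on `(a, b)`. -/
def HasWeakDeriv {a b : ℝ} (u g : L2 a b) : Prop :=
  ∀ φ : ℝ → ℂ, IsTest a b φ →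
    ∫ x in Ioo a b, u x * deriv φ x = - ∫ x in Ioo a b, g x * φ x

variable {a b : ℝ}

namespace IsTest

theorem memLp {φ : ℝ → ℂ} (h : IsTest a b φ) : MemLp φ 2 (volume.restrict (Ioo a b)) :=
  (h.contDiff.continuous.memLp_of_hasCompactSupport h.hasCompactSupport).restrict _

theorem deriv {φ : ℝ → ℂ} (h : IsTest a b φ) : IsTest a b (deriv φ) where
  contDiff := ((contDiff_infty_iff_deriv (𝕜 := ℝ)).1 h.contDiff).2
  hasCompactSupport := h.hasCompactSupport.deriv
  tsupport_subset := (tsupport_deriv_subset (𝕜 := ℝ)).trans h.tsupport_subset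

theorem zero : IsTest a b 0 :=
  ⟨contDiff_const, HasCompactSupport.zero, by simp [tsupport]⟩

theorem add {φ ψ : ℝ → ℂ} (h : IsTest a b φ) (h' : IsTest a b ψ) : IsTest a b (φ + ψ) :=
  ⟨h.contDiff.add h'.contDiff, h.hasCompactSupport.add h'.hasCompactSupport,
    (tsupport_add φ ψ).trans (union_subset h.tsupport_subset h'.tsupport_subset)⟩

theorem smul {φ : ℝ → ℂ} (c : ℂ) (h : IsTest a b φ) : IsTest a b (c • φ) :=
  ⟨h.contDiff.const_smul c, h.hasCompactSupport.smul_left (f := fun _ => c),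
    (tsupport_smul_subset_right (fun _ => c) φ).trans h.tsupport_subset⟩

theorem ofReal {φ : ℝ → ℝ} (h : ContDiff ℝ ∞ φ) (hc : HasCompactSupport φ)
    (hs : tsupport φ ⊆ Ioo a b) : IsTest a b (fun x => (φ x : ℂ)) where
  contDiff := Complex.ofRealCLM.contDiff.comp h
  hasCompactSupport := hc.comp_left (g := fun x : ℝ => (x : ℂ)) Complex.ofReal_zero
  tsupport_subset :=
    (tsupport_comp_subset (g := fun x : ℝ => (x : ℂ)) Complex.ofReal_zero φ).trans hs

end IsTest

theorem integrable_mul_test (u : L2 a b) {φ : ℝ → ℂ} (h : IsTest a b φ) :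
    Integrable (fun x => u x * φ x) (volume.restrict (Ioo a b)) :=
  (Lp.memLp u).integrable_mul h.memLp

theorem integrable_coe (u : L2 a b) : Integrable (fun x => u x) (volume.restrict (Ioo a b)) :=
  (Lp.memLp u).integrable (by norm_num)

theorem HasWeakDeriv.add {u g u' g' : L2 a b} (h : HasWeakDeriv u g) (h' : HasWeakDeriv u' g') :
    HasWeakDeriv (u + u') (g + g') := by
  intro φ hφ
  have e1 : ∫ x in Ioo a b, (u + u') x * _root_.deriv φ x
      = ∫ x in Ioo a b, (u x * _root_.deriv φ x + u' x * _root_.deriv φ x) := by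
    refine integral_congr_ae ?_
    filter_upwards [Lp.coeFn_add u u'] with x hx
    rw [hx, Pi.add_apply, add_mul]
  have e2 : ∫ x in Ioo a b, (g + g') x * φ x
      = ∫ x in Ioo a b, (g x * φ x + g' x * φ x) := by
    refine integral_congr_ae ?_
    filter_upwards [Lp.coeFn_add g g'] with x hx
    rw [hx, Pi.add_apply, add_mul]
  rw [e1, e2, integral_add (integrable_mul_test u hφ.deriv) (integrable_mul_test u' hφ.deriv),
    integral_add (integrable_mul_test g hφ) (integrable_mul_test g' hφ), h φ hφ, h' φ hφ]
  ring

theorem HasWeakDeriv.smul {u g : L2 a b} (c : ℂ) (h : HasWeakDeriv u g) :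
    HasWeakDeriv (c • u) (c • g) := by
  intro φ hφ
  have e1 : ∫ x in Ioo a b, (c • u) x * _root_.deriv φ x
      = ∫ x in Ioo a b, c * (u x * _root_.deriv φ x) := by
    refine integral_congr_ae ?_
    filter_upwards [Lp.coeFn_smul c u] with x hx
    rw [hx, Pi.smul_apply, smul_eq_mul, mul_assoc]
  have e2 : ∫ x in Ioo a b, (c • g) x * φ x = ∫ x in Ioo a b, c * (g x * φ x) := by
    refine integral_congr_ae ?_
    filter_upwards [Lp.coeFn_smul c g] with x hx
    rw [hx, Pi.smul_apply, smul_eq_mul, mul_assoc]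
  rw [e1, e2, integral_const_mul, integral_const_mul, h φ hφ]
  ring

theorem HasWeakDeriv.zero : HasWeakDeriv (0 : L2 a b) 0 := by
  intro φ _
  have e (ψ : ℝ → ℂ) : ∫ x in Ioo a b, (0 : L2 a b) x * ψ x = 0 := by
    rw [← integral_zero ℝ ℂ (μ := volume.restrict (Ioo a b))]
    refine integral_congr_ae ?_
    filter_upwards [Lp.coeFn_zero ℂ 2 (volume.restrict (Ioo a b))] with x hx
    rw [hx]; simp
  rw [e, e, neg_zero]

/-- The fundamental lemma of the calculus of variations on `(a, b)`. -/
theorem ae_eq_zero_of_test {f : ℝ → ℂ} (hf : Integrable f (volume.restrict (Ioo a b)))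
    (h : ∀ φ : ℝ → ℂ, IsTest a b φ → ∫ x in Ioo a b, f x * φ x = 0) :
    f =ᵐ[volume.restrict (Ioo a b)] 0 := by
  have := isOpen_Ioo.ae_eq_zero_of_integral_contDiff_smul_eq_zero (μ := volume) (f := f)
    (U := Ioo a b) (IntegrableOn.locallyIntegrableOn hf) (by
      intro φ h1 h2 h3
      rw [← h _ (IsTest.ofReal h1 h2 h3), ← setIntegral_eq_integral_of_forall_compl_eq_zero
        (s := Ioo a b)]
      · refine integral_congr_ae (Eventually.of_forall fun x => ?_)
        simp [mul_comm]
      · intro x hx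
        rw [image_eq_zero_of_notMem_tsupport (fun hx' => hx (h3 hx')), zero_smul])
  exact (ae_restrict_iff' measurableSet_Ioo).2 this

theorem HasWeakDeriv.unique {u g g' : L2 a b} (h : HasWeakDeriv u g) (h' : HasWeakDeriv u g') :
    g = g' := by
  have key := ae_eq_zero_of_test ((integrable_coe g).sub (integrable_coe g')) (fun φ hφ => by
    have e : ∫ x in Ioo a b, ((fun x => g x) - fun x => g' x) x * φ x
        = ∫ x in Ioo a b, (g x * φ x - g' x * φ x) :=
      integral_congr_ae (Eventually.of_forall fun x => by simp [sub_mul])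
    rw [e, integral_sub (integrable_mul_test g hφ) (integrable_mul_test g' hφ)]
    have := (h φ hφ).symm.trans (h' φ hφ)
    rw [neg_inj.1 this, sub_self])
  refine Lp.ext ?_
  filter_upwards [key] with x hx
  exact sub_eq_zero.1 hx

/-- The Sobolev space `W^{1,2}(a, b)`: the `u ∈ L²(a, b)` with a weak derivative in `L²(a, b)`. -/
def W12 (a b : ℝ) : Submodule ℂ (L2 a b) where
  carrier := {u | ∃ g : L2 a b, HasWeakDeriv u g}
  zero_mem' := ⟨0, HasWeakDeriv.zero⟩
  add_mem' := by
    rintro u v ⟨g, hg⟩ ⟨k, hk⟩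
    exact ⟨g + k, hg.add hk⟩
  smul_mem' := by
    rintro c u ⟨g, hg⟩
    exact ⟨c • g, hg.smul c⟩

/-- The weak derivative `u ↦ u'` on `W^{1,2}(a, b)`. -/
noncomputable def weakDeriv (a b : ℝ) : W12 a b →ₗ[ℂ] L2 a b where
  toFun u := u.2.choose
  map_add' u v := (u + v).2.choose_spec.unique (u.2.choose_spec.add v.2.choose_spec)
  map_smul' c u := (c • u).2.choose_spec.unique (u.2.choose_spec.smul c)

theorem hasWeakDeriv_weakDeriv (u : W12 a b) : HasWeakDeriv (u : L2 a b) (weakDeriv a b u) :=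
  u.2.choose_spec

theorem IsTest.eq_zero {φ : ℝ → ℂ} (h : IsTest a b φ) {x : ℝ} (hx : x ∉ Ioo a b) : φ x = 0 :=
  image_eq_zero_of_notMem_tsupport fun hx' => hx (h.tsupport_subset hx')

/-- The primitive of a test function with vanishing integral is a test function. -/
theorem IsTest.primitive {θ : ℝ → ℂ} (hab : a < b) (h : IsTest a b θ)
    (h0 : ∫ x in Ioo a b, θ x = 0) :
    IsTest a b (fun x => ∫ t in a..x, θ t) ∧
      _root_.deriv (fun x => ∫ t in a..x, θ t) = θ := by
  have hc := h.contDiff.continuous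
  have hd : ∀ x, HasDerivAt (fun x => ∫ t in a..x, θ t) (θ x) x := fun x =>
    intervalIntegral.integral_hasDerivAt_right (hc.intervalIntegrable _ _)
      (hc.stronglyMeasurableAtFilter _ _) hc.continuousAt
  have hderiv : _root_.deriv (fun x => ∫ t in a..x, θ t) = θ := funext fun x => (hd x).deriv
  refine ⟨?_, hderiv⟩
  obtain ⟨a', b', ha', hb', hK⟩ : ∃ a' b', a < a' ∧ b' < b ∧ tsupport θ ⊆ Icc a' b' := by
    rcases (tsupport θ).eq_empty_or_nonempty with he | hne
    · exact ⟨a + 1, b - 1, by linarith, by linarith, by simp [he]⟩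
    · obtain ⟨m, hm, hm'⟩ := h.hasCompactSupport.isCompact.exists_isLeast hne
      obtain ⟨M, hM, hM'⟩ := h.hasCompactSupport.isCompact.exists_isGreatest hne
      exact ⟨m, M, (h.tsupport_subset hm).1, (h.tsupport_subset hM).2,
        fun x hx => ⟨hm' hx, hM' hx⟩⟩
  have hz : ∀ x, x ∉ Icc a' b' → θ x = 0 := fun x hx =>
    image_eq_zero_of_notMem_tsupport fun hx' => hx (hK hx')
  have h0' : ∫ t in a..b, θ t = 0 := by
    rw [intervalIntegral.integral_of_le hab.le, integral_Ioc_eq_integral_Ioo, h0]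
  have hsupp : Function.support (fun x => ∫ t in a..x, θ t) ⊆ Icc a' b' := by
    intro x hx
    by_contra hxK
    refine hx ?_
    rw [mem_Icc, not_and_or, not_le, not_le] at hxK
    rcases hxK with hxa | hxb
    · change ∫ t in a..x, θ t = 0
      rw [intervalIntegral.integral_congr (g := fun _ => (0 : ℂ))]
      · simp
      · intro t ht
        refine hz t fun ht' => ?_
        have := (mem_uIcc.1 ht)
        rcases this with h1 | h1 <;> linarith [ht'.1, h1.1, h1.2]
    · change ∫ t in a..x, θ t = 0
      rw [← intervalIntegral.integral_add_adjacent_intervals (hc.intervalIntegrable a b)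
        (hc.intervalIntegrable b x), h0', zero_add,
        intervalIntegral.integral_congr (g := fun _ => (0 : ℂ))]
      · simp
      · intro t ht
        refine hz t fun ht' => ?_
        have := (mem_uIcc.1 ht)
        rcases this with h1 | h1 <;> linarith [ht'.2, h1.1, h1.2]
  refine ⟨contDiff_infty_iff_deriv.2 ⟨fun x => (hd x).differentiableAt, by
      rw [hderiv]; exact h.contDiff⟩,
    HasCompactSupport.of_support_subset_isCompact isCompact_Icc hsupp, ?_⟩
  exact (closure_minimal hsupp isClosed_Icc).trans fun x hx =>
    ⟨ha'.trans_le hx.1, hx.2.trans_lt hb'⟩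

theorem exists_test_integral_one (hab : a < b) :
    ∃ ψ : ℝ → ℂ, IsTest a b ψ ∧ ∫ x in Ioo a b, ψ x = 1 := by
  let B : ContDiffBump ((a + b) / 2 : ℝ) := ⟨(b - a) / 8, (b - a) / 4, by linarith, by linarith⟩
  have hs : tsupport (B.normed volume) ⊆ Ioo a b := by
    rw [B.tsupport_normed_eq, Real.closedBall_eq_Icc]
    intro x hx
    change (a + b) / 2 - (b - a) / 4 ≤ x ∧ x ≤ (a + b) / 2 + (b - a) / 4 at hx
    constructor <;> linarith [hx.1, hx.2]
  have ht := IsTest.ofReal B.contDiff_normed B.hasCompactSupport_normed hs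
  refine ⟨_, ht, ?_⟩
  rw [setIntegral_eq_integral_of_forall_compl_eq_zero fun x hx => ht.eq_zero hx,
    integral_complex_ofReal, B.integral_normed]
  simp

/-- A function with vanishing weak derivative is constant. -/
theorem ae_eq_const_of_test (hab : a < b) {f : ℝ → ℂ}
    (hf : Integrable f (volume.restrict (Ioo a b)))
    (h : ∀ φ : ℝ → ℂ, IsTest a b φ → ∫ x in Ioo a b, f x * deriv φ x = 0) :
    ∃ c : ℂ, f =ᵐ[volume.restrict (Ioo a b)] fun _ => c := by
  obtain ⟨ψ, hψ, hψ1⟩ := exists_test_integral_one hab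
  have hint : ∀ {φ : ℝ → ℂ}, IsTest a b φ →
      Integrable φ (volume.restrict (Ioo a b)) := fun hφ => hφ.memLp.integrable (by norm_num)
  have hfi : ∀ {φ : ℝ → ℂ}, IsTest a b φ →
      Integrable (fun x => f x * φ x) (volume.restrict (Ioo a b)) := by
    intro φ hφ
    obtain ⟨C, hC⟩ := hφ.contDiff.continuous.bounded_above_of_compact_support
      hφ.hasCompactSupport
    exact hf.mul_bdd (c := C) hφ.contDiff.continuous.aestronglyMeasurable (Eventually.of_forall hC)
  set c := ∫ x in Ioo a b, f x * ψ x with hc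
  refine ⟨c, ?_⟩
  have key := ae_eq_zero_of_test (f := fun x => f x - c) (hf.sub (integrable_const c)) (fun φ hφ => by
    set I := ∫ x in Ioo a b, φ x with hI
    have hθ : IsTest a b (φ + (-I) • ψ) := hφ.add (hψ.smul _)
    have hθ0 : ∫ x in Ioo a b, (φ + (-I) • ψ) x = 0 := by
      simp only [Pi.add_apply, Pi.smul_apply, smul_eq_mul]
      rw [integral_add (hint hφ) ((hint hψ).const_mul _), integral_const_mul, hψ1]
      simp [hI]
    obtain ⟨hΦ, hΦ'⟩ := hθ.primitive hab hθ0
    have h1 := h _ hΦ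
    rw [hΦ'] at h1
    have e1 : ∫ x in Ioo a b, f x * (φ + (-I) • ψ) x
        = (∫ x in Ioo a b, f x * φ x) + (-I) * c := by
      rw [hc, ← integral_const_mul, ← integral_add (hfi hφ) ((hfi hψ).const_mul _)]
      refine integral_congr_ae (Eventually.of_forall fun x => ?_)
      simp only [Pi.add_apply, Pi.smul_apply, smul_eq_mul]
      ring
    have e2 : ∫ x in Ioo a b, (f x - c) * φ x
        = (∫ x in Ioo a b, f x * φ x) - c * I := by
      rw [hI, ← integral_const_mul, ← integral_sub (hfi hφ) ((hint hφ).const_mul _)]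
      refine integral_congr_ae (Eventually.of_forall fun x => ?_)
      ring
    rw [e2]
    rw [e1] at h1
    linear_combination h1)
  filter_upwards [key] with x hx
  exact sub_eq_zero.1 hx

/-- The primitive of `g` has weak derivative `g`. -/
theorem integral_primitive_mul_deriv {g : ℝ → ℂ}
    (hg : Integrable g (volume.restrict (Ioo a b))) {φ : ℝ → ℂ} (hφ : IsTest a b φ) :
    ∫ x in Ioo a b, (∫ t in a..x, g t) * deriv φ x = - ∫ x in Ioo a b, g x * φ x := by
  have hφi : Integrable (deriv φ) (volume.restrict (Ioo a b)) :=
    hφ.deriv.memLp.integrable (by norm_num)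
  set F : ℝ × ℝ → ℂ := {p : ℝ × ℝ | p.2 < p.1}.indicator fun p => deriv φ p.1 * g p.2 with hF
  have hFi : Integrable F ((volume.restrict (Ioo a b)).prod (volume.restrict (Ioo a b))) :=
    (hφi.mul_prod hg).indicator (measurableSet_lt measurable_snd measurable_fst)
  have e1 : ∫ x in Ioo a b, (∫ t in a..x, g t) * deriv φ x
      = ∫ x in Ioo a b, ∫ t in Ioo a b, F (x, t) := by
    refine setIntegral_congr_fun measurableSet_Ioo fun x hx => ?_
    have : ∀ t, F (x, t) = (Iio x).indicator (fun t => deriv φ x * g t) t := fun t => rfl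
    simp only [this]
    rw [setIntegral_indicator measurableSet_Iio, Ioo_inter_Iio, min_eq_right hx.2.le,
      integral_const_mul, intervalIntegral.integral_of_le hx.1.le, integral_Ioc_eq_integral_Ioo,
      mul_comm]
  have e2 : ∫ t in Ioo a b, ∫ x in Ioo a b, F (x, t) = ∫ t in Ioo a b, -(g t * φ t) := by
    refine setIntegral_congr_fun measurableSet_Ioo fun t ht => ?_
    have : ∀ x, F (x, t) = (Ioi t).indicator (fun x => deriv φ x * g t) x := fun x => rfl
    simp only [this]
    rw [setIntegral_indicator measurableSet_Ioi, Ioo_inter_Ioi, max_eq_right ht.1.le,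
      integral_mul_const, ← integral_Ioc_eq_integral_Ioo,
      ← intervalIntegral.integral_of_le ht.2.le,
      intervalIntegral.integral_deriv_eq_sub (fun x _ => (hφ.contDiff.differentiable
        (by simp)).differentiableAt) (hφ.deriv.contDiff.continuous.intervalIntegrable _ _),
      hφ.eq_zero (x := b) (by simp)]
    ring
  rw [e1, integral_integral_swap (f := fun x t => F (x, t)) hFi, e2, integral_neg]

/-- The embedding `W^{1,2}(a, b) ⊂ C([a, b])`. -/
theorem exists_continuous_rep (hab : a < b) (u : W12 a b) :
    ∃ w : ℝ → ℂ, ContinuousOn w (Icc a b) ∧ (u : L2 a b) =ᵐ[volume.restrict (Ioo a b)] w := by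
  set g := weakDeriv a b u with hgdef
  have hu := hasWeakDeriv_weakDeriv u
  have hg : IntegrableOn (fun x => g x) (Icc a b) :=
    (integrableOn_Icc_iff_integrableOn_Ioo (by finiteness) (by finiteness)).2 (integrable_coe g)
  have hG : ContinuousOn (fun x => ∫ t in a..x, g t) (Icc a b) :=
    intervalIntegral.continuousOn_primitive_interval (by rwa [uIcc_of_le hab.le]) |>.mono
      (by rw [uIcc_of_le hab.le])
  have hGi : Integrable (fun x => ∫ t in a..x, g t) (volume.restrict (Ioo a b)) :=
    (hG.integrableOn_Icc).mono_set Ioo_subset_Icc_self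
  obtain ⟨c, hc⟩ := ae_eq_const_of_test hab ((integrable_coe (u : L2 a b)).sub hGi)
    (fun φ hφ => by
      obtain ⟨C, hC⟩ := hφ.deriv.contDiff.continuous.bounded_above_of_compact_support
        hφ.deriv.hasCompactSupport
      have i2 := hGi.mul_bdd (c := C) (hφ.deriv.contDiff.continuous.aestronglyMeasurable)
        (Eventually.of_forall hC)
      have e : ∫ x in Ioo a b,
          ((fun x => (u : L2 a b) x) - fun x => ∫ t in a..x, g t) x * deriv φ x
          = ∫ x in Ioo a b, ((u : L2 a b) x * deriv φ x - (∫ t in a..x, g t) * deriv φ x) :=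
        integral_congr_ae (Eventually.of_forall fun x => by simp [sub_mul])
      rw [e, integral_sub (integrable_mul_test _ hφ.deriv) i2, hu φ hφ,
        integral_primitive_mul_deriv (integrable_coe g) hφ, sub_self])
  refine ⟨fun x => (∫ t in a..x, g t) + c, hG.add continuousOn_const, ?_⟩
  filter_upwards [hc] with x hx
  rw [← hx]
  simp

theorem eqOn_of_ae_eq (hab : a < b) {w w' : ℝ → ℂ} (h : ContinuousOn w (Icc a b))
    (h' : ContinuousOn w' (Icc a b)) (he : w =ᵐ[volume.restrict (Ioo a b)] w') :
    EqOn w w' (Icc a b) := by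
  refine Measure.eqOn_Icc_of_ae_eq (μ := volume) hab.ne ?_ h h'
  rwa [restrict_Ioo_eq_restrict_Icc] at he

/-- The value `u(x)`, `x ∈ [a, b]`, of `u ∈ W^{1,2}(a, b)`, that is, of the continuous
representative of `u`. -/
noncomputable def eval (hab : a < b) (x : ℝ) (hx : x ∈ Icc a b) : W12 a b →ₗ[ℂ] ℂ where
  toFun u := (exists_continuous_rep hab u).choose x
  map_add' u v := by
    have hu := (exists_continuous_rep hab u).choose_spec
    have hv := (exists_continuous_rep hab v).choose_spec
    have huv := (exists_continuous_rep hab (u + v)).choose_spec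
    refine eqOn_of_ae_eq hab huv.1 (hu.1.add hv.1) ?_ hx
    filter_upwards [hu.2, hv.2, huv.2, Lp.coeFn_add (u : L2 a b) v] with x h1 h2 h3 h4
    rw [← h3, Pi.add_apply, ← h1, ← h2]
    exact h4
  map_smul' c u := by
    have hu := (exists_continuous_rep hab u).choose_spec
    have hcu := (exists_continuous_rep hab (c • u)).choose_spec
    refine eqOn_of_ae_eq hab hcu.1 (hu.1.const_smul c) ?_ hx
    filter_upwards [hu.2, hcu.2, Lp.coeFn_smul c (u : L2 a b)] with x h1 h2 h3
    rw [← h2, Pi.smul_apply, ← h1]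
    exact h3

theorem eval_eq (hab : a < b) {x : ℝ} (hx : x ∈ Icc a b) (u : W12 a b) {w : ℝ → ℂ}
    (hw : ContinuousOn w (Icc a b)) (hu : (u : L2 a b) =ᵐ[volume.restrict (Ioo a b)] w) :
    eval hab x hx u = w x :=
  have h := (exists_continuous_rep hab u).choose_spec
  eqOn_of_ae_eq hab h.1 hw (h.2.symm.trans hu) hx

/-- `C_c^∞(a, b)` as a subspace of `L²(a, b)`. -/
def testSpace (a b : ℝ) : Submodule ℂ (L2 a b) where
  carrier := {u | ∃ φ : ℝ → ℂ, IsTest a b φ ∧ u =ᵐ[volume.restrict (Ioo a b)] φ}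
  zero_mem' := ⟨0, IsTest.zero, Lp.coeFn_zero _ _ _⟩
  add_mem' := by
    rintro u v ⟨φ, hφ, hu⟩ ⟨ψ, hψ, hv⟩
    exact ⟨φ + ψ, hφ.add hψ, (Lp.coeFn_add u v).trans (hu.add hv)⟩
  smul_mem' := by
    rintro c u ⟨φ, hφ, hu⟩
    exact ⟨c • φ, hφ.smul c, (Lp.coeFn_smul c u).trans (hu.const_smul c)⟩

theorem testSpace_le_W12 : testSpace a b ≤ W12 a b := by
  rintro u ⟨φ, hφ, hu⟩
  refine ⟨hφ.deriv.memLp.toLp _, fun χ hχ => ?_⟩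
  have e1 : ∫ x in Ioo a b, u x * deriv χ x = ∫ x, φ x * deriv χ x := by
    rw [← setIntegral_eq_integral_of_forall_compl_eq_zero (s := Ioo a b)
      (f := fun x => φ x * deriv χ x) fun x hx => by rw [hφ.eq_zero hx, zero_mul]]
    refine integral_congr_ae ?_
    filter_upwards [hu] with x hx
    rw [hx]
  have e2 : ∫ x in Ioo a b, (hφ.deriv.memLp.toLp _ : L2 a b) x * χ x
      = ∫ x, deriv φ x * χ x := by
    rw [← setIntegral_eq_integral_of_forall_compl_eq_zero (s := Ioo a b)
      (f := fun x => deriv φ x * χ x) fun x hx => by rw [hχ.eq_zero hx, mul_zero]]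
    refine integral_congr_ae ?_
    filter_upwards [hφ.deriv.memLp.coeFn_toLp] with x hx
    rw [hx]
  have hd : ∀ {ψ : ℝ → ℂ}, IsTest a b ψ → ∀ x, HasDerivAt ψ (deriv ψ x) x := fun hψ x =>
    (hψ.contDiff.differentiable (by simp)).differentiableAt.hasDerivAt
  rw [e1, e2]
  refine integral_mul_deriv_eq_deriv_mul_of_integrable (fun x _ => hd hφ x) (fun x _ => hd hχ x) ?_ ?_ ?_
  · exact (hφ.contDiff.continuous.mul hχ.deriv.contDiff.continuous).integrable_of_hasCompactSupport
      hφ.hasCompactSupport.mul_right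
  · exact (hφ.deriv.contDiff.continuous.mul hχ.contDiff.continuous).integrable_of_hasCompactSupport
      hχ.hasCompactSupport.mul_left
  · exact (hφ.contDiff.continuous.mul hχ.contDiff.continuous).integrable_of_hasCompactSupport
      hφ.hasCompactSupport.mul_right

theorem dense_testSpace : Dense (testSpace a b : Set (L2 a b)) := by
  rw [Submodule.dense_iff_topologicalClosure_eq_top, Submodule.topologicalClosure_eq_top_iff,
    Submodule.eq_bot_iff]
  intro f hf
  have key := ae_eq_zero_of_test (integrable_coe f) (fun φ hφ => by
    have hφ' : IsTest a b (fun x => (starRingEnd ℂ) (φ x)) := by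
      refine ⟨Complex.conjCLE.contDiff.comp hφ.contDiff, ?_, ?_⟩
      · exact hφ.hasCompactSupport.comp_left (map_zero (starRingEnd ℂ))
      · exact (tsupport_comp_subset (map_zero (starRingEnd ℂ)) φ).trans hφ.tsupport_subset
    have h1 := (Submodule.mem_orthogonal _ _).1 hf (hφ'.memLp.toLp _)
      ⟨_, hφ', hφ'.memLp.coeFn_toLp⟩
    rw [L2.inner_def] at h1
    rw [← h1]
    refine integral_congr_ae ?_
    filter_upwards [hφ'.memLp.coeFn_toLp] with x hx
    rw [hx]
    simp [RCLike.inner_apply])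
  exact Lp.ext (key.trans (Lp.coeFn_zero _ _ _).symm)

/-- `u ↦ (u, u')`, which induces the topology of `W^{1,2}(a, b)`. -/
noncomputable def jet (a b : ℝ) : W12 a b →ₗ[ℂ] L2 a b × L2 a b :=
  (W12 a b).subtype.prod (weakDeriv a b)

/-- `W_0^{1,2}(a, b)`: the closure of `C_c^∞(a, b)` in `W^{1,2}(a, b)`. -/
noncomputable def W120 (a b : ℝ) : Submodule ℂ (L2 a b) :=
  Submodule.map (W12 a b).subtype <| Submodule.comap (jet a b) <| Submodule.topologicalClosure <|
    Submodule.map (jet a b) <| Submodule.comap (W12 a b).subtype (testSpace a b)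

theorem W120_le_W12 : W120 a b ≤ W12 a b := Submodule.map_subtype_le _ _

theorem testSpace_le_W120 : testSpace a b ≤ W120 a b := fun u hu =>
  ⟨⟨u, testSpace_le_W12 hu⟩, Submodule.le_topologicalClosure _ ⟨⟨u, testSpace_le_W12 hu⟩, hu, rfl⟩,
    rfl⟩

end IntervalSobolev

/-! ### A single δ-interaction on a bounded interval -/

namespace DeltaInteraction

open UnboundedOp IntervalSobolev

variable {xm xp : ℝ}

theorem left_mem (hx : xm < xp) : xm ∈ Icc xm xp := left_mem_Icc.2 hx.le

theorem right_mem (hx : xm < xp) : xp ∈ Icc xm xp := right_mem_Icc.2 hx.le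

theorem mid_mem (hx : xm < xp) : (xm + xp) / 2 ∈ Icc xm xp := ⟨by linarith, by linarith⟩

/-- The expression `(u', v')_{L²} + α u(y) conj v(y)` on `W^{1,2}(x₋, x₊)`. -/
noncomputable def deltaExpr (hx : xm < xp) (α : ℝ) :
    W12 xm xp →ₗ[ℂ] W12 xm xp →ₛₗ[starRingEnd ℂ] ℂ :=
  LinearMap.mk₂'ₛₗ (RingHom.id ℂ) (starRingEnd ℂ)
    (fun u v => inner ℂ (weakDeriv xm xp v) (weakDeriv xm xp u)
      + α * (eval hx _ (mid_mem hx) u * starRingEnd ℂ (eval hx _ (mid_mem hx) v)))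
    (fun u u' v => by simp only [map_add, inner_add_right]; ring)
    (fun c u v => by simp only [map_smul, inner_smul_right, smul_eq_mul, RingHom.id_apply]; ring)
    (fun u v v' => by simp only [map_add, inner_add_left]; ring)
    (fun c u v => by simp only [map_smul, inner_smul_left, smul_eq_mul, map_mul]; ring)

/-- The expression
`(u', v')_{L²} + α u(y) conj v(y) + ½ (β₋ u(x₋) conj v(x₋) + β₊ u(x₊) conj v(x₊))`
on `W^{1,2}(x₋, x₊)`, where `y` is the midpoint. -/
noncomputable def robinExpr (hx : xm < xp) (α βm βp : ℝ) :
    W12 xm xp →ₗ[ℂ] W12 xm xp →ₛₗ[starRingEnd ℂ] ℂ :=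
  LinearMap.mk₂'ₛₗ (RingHom.id ℂ) (starRingEnd ℂ)
    (fun u v => deltaExpr hx α u v
      + 1 / 2 * (βm * (eval hx xm (left_mem hx) u * starRingEnd ℂ (eval hx xm (left_mem hx) v))
        + βp * (eval hx xp (right_mem hx) u * starRingEnd ℂ (eval hx xp (right_mem hx) v))))
    (fun u u' v => by simp only [map_add, LinearMap.add_apply]; ring)
    (fun c u v => by simp only [map_smul, LinearMap.smul_apply, smul_eq_mul, RingHom.id_apply]; ring)
    (fun u v v' => by simp only [map_add]; ring)
    (fun c u v => by simp only [map_smul, map_smulₛₗ, smul_eq_mul, map_mul]; ring)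

/-- The form with Dirichlet boundary conditions, with domain `W_0^{1,2}(x₋, x₊)`. -/
noncomputable def dirichletForm (hx : xm < xp) (α : ℝ) : DenseForm (L2 xm xp) where
  domain := W120 xm xp
  form := LinearMap.mk₂'ₛₗ (RingHom.id ℂ) (starRingEnd ℂ)
    (fun u v => deltaExpr hx α (Submodule.inclusion W120_le_W12 u)
      (Submodule.inclusion W120_le_W12 v))
    (fun u u' v => by simp only [map_add, LinearMap.add_apply])
    (fun c u v => by simp only [map_smul, LinearMap.smul_apply, RingHom.id_apply])
    (fun u v v' => by simp only [map_add])
    (fun c u v => by simp only [map_smul, map_smulₛₗ])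
  dense := dense_testSpace.mono testSpace_le_W120

/-- The form with Robin boundary conditions, with domain `W^{1,2}(x₋, x₊)`. -/
noncomputable def robinForm (hx : xm < xp) (α βm βp : ℝ) : DenseForm (L2 xm xp) where
  domain := W12 xm xp
  form := robinExpr hx α βm βp
  dense := dense_testSpace.mono testSpace_le_W12

/-- The operator `-d²/dx² + α δ_y` on `(x₋, x₊)` with Dirichlet boundary conditions. -/
noncomputable def dirichletOp (hx : xm < xp) (α : ℝ) : L2 xm xp →ₗ.[ℂ] L2 xm xp :=
  (dirichletForm hx α).operator

/-- The operator `-d²/dx² + α δ_y` on `(x₋, x₊)` with the boundary conditions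
`u'(x₋) = ½ β₋ u(x₋)`, `u'(x₊) = -½ β₊ u(x₊)`. -/
noncomputable def robinOp (hx : xm < xp) (α βm βp : ℝ) : L2 xm xp →ₗ.[ℂ] L2 xm xp :=
  (robinForm hx α βm βp).operator

end DeltaInteraction

/-! Both operators fit one abstract pattern, `HasCompactResolvent`: the form h is symmetric, h + c
is positive definite, and a compact K represents h + c, so that K is the inverse of A + c
(`mem_graph_iff`). The eigenspace of A at z is that of K at 1/(z + c). Symmetry of K gives
self-adjointness of A. The spectral theorem and the Fredholm alternative for K give a discrete
spectrum above -c, unbounded above because L² is infinite dimensional.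

The pattern is verified by Lax-Milgram on the Hilbert space of pairs (u, u'). The estimate |u(x)|² ≤
2ε‖u'‖² + (2/ε)‖u‖² makes all point terms small relative to the Dirichlet integral, whatever the
signs of the coefficients (`exists_coercive`). The embedding into L² is compact because functions
vanishing on a fine grid are small (`isCompactOperator_of_small_on_ker`).

Convergence rests on the min-max principle (`nthEigenvalue_eq_sInf_trialValues`). Functions in the
Dirichlet form domain vanish at the end points, so every Dirichlet trial space is a Robin trial
space with the same bound, and Robin eigenvalues never exceed Dirichlet ones. Conversely, on a Robin
trial space with bounded energy and large β, the squared boundary values are at most of order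
‖u‖²/min β. Subtracting the affine function with the same boundary values therefore changes norm and
energy only by factors close to 1 and stays injective, which yields a Dirichlet trial space with
almost the same bound (`exists_dirichlet_trialValue`). The shift c comes from the form without
boundary terms, hence does not depend on β. -/

/-! ### Semibounded forms with compact resolvent -/

namespace UnboundedOp

variable {H : Type*} [NormedAddCommGroup H] [InnerProductSpace ℂ H]

/-- The span of the eigenspaces for the eigenvalues `≤ t`. -/
def spectralSubspace (A : H →ₗ.[ℂ] H) (t : ℝ) : Submodule ℂ H :=
  ⨆ μ : ℝ, ⨆ _ : μ ≤ t, eigenspace A (μ : ℂ)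

theorem nthEigenvalue_eq (A : H →ₗ.[ℂ] H) (j : ℕ) :
    nthEigenvalue A j = sInf {t : ℝ | (j : Cardinal) ≤ Module.rank ℂ (spectralSubspace A t)} :=
  rfl

theorem eigenspace_le_spectralSubspace (A : H →ₗ.[ℂ] H) {μ t : ℝ} (h : μ ≤ t) :
    eigenspace A (μ : ℂ) ≤ spectralSubspace A t :=
  le_iSup₂_of_le μ h le_rfl

theorem mem_spectrum_of_eigenspace_ne_bot {A : H →ₗ.[ℂ] H} {z : ℂ} (hz : eigenspace A z ≠ ⊥) :
    z ∈ spectrum A := by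
  rintro ⟨R, -, hR⟩
  obtain ⟨u, hu, hu0⟩ := Submodule.exists_mem_ne_zero_of_ne_bot hz
  obtain ⟨hm, hA⟩ := mem_eigenspace.1 hu
  have := hR ⟨u, hm⟩
  rw [hA] at this
  exact hu0 (by simpa using this.symm)

/-- A quadratic form which is diagonal in an orthogonal decomposition. -/
theorem inner_sum_smul_of_pairwise_orthogonal {ι : Type*} (s : Finset ι) (v : ι → H)
    (hv : ∀ i ∈ s, ∀ k ∈ s, i ≠ k → inner ℂ (v i) (v k) = 0) (m : ι → ℝ) :
    inner ℂ (∑ i ∈ s, v i) (∑ i ∈ s, (m i : ℂ) • v i) = ((∑ i ∈ s, m i * ‖v i‖ ^ 2 : ℝ) : ℂ) := by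
  rw [sum_inner]
  push_cast
  refine Finset.sum_congr rfl fun i hi => ?_
  rw [inner_sum, Finset.sum_eq_single i]
  · rw [inner_smul_right, inner_self_eq_norm_sq_to_K]
    simp
  · intro k hk hki
    rw [inner_smul_right, hv i hi k hk hki.symm, mul_zero]
  · exact fun h => absurd hi h

theorem norm_sq_sum_of_pairwise_orthogonal {ι : Type*} (s : Finset ι) (v : ι → H)
    (hv : ∀ i ∈ s, ∀ k ∈ s, i ≠ k → inner ℂ (v i) (v k) = 0) :
    ‖∑ i ∈ s, v i‖ ^ 2 = ∑ i ∈ s, ‖v i‖ ^ 2 := by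
  have h := inner_sum_smul_of_pairwise_orthogonal s v hv (fun _ => 1)
  simp only [Complex.ofReal_one, one_smul, one_mul] at h
  rw [inner_self_eq_norm_sq_to_K] at h
  exact Complex.ofReal_injective (by rw [Complex.ofReal_pow]; exact h)

namespace DenseForm

/-- `h` is symmetric, `h + c` is positive definite, and `h + c` is represented by the inverse of
the compact operator `K`. -/
structure HasCompactResolvent (h : DenseForm H) (c : ℝ) (K : H →L[ℂ] H) : Prop where
  symm : ∀ u v, starRingEnd ℂ (h.form u v) = h.form v u
  pos : ∀ u : h.domain, u ≠ 0 → 0 < (h.form u u).re + c * ‖(u : H)‖ ^ 2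
  compact : IsCompactOperator K
  mem_domain : ∀ f, K f ∈ h.domain
  form_add : ∀ (f : H) (v : h.domain),
    h.form ⟨K f, mem_domain f⟩ v + c * inner ℂ (v : H) (K f) = inner ℂ (v : H) f

/-- The values `t` for which there is a `j`-dimensional subspace of the form domain on which the
form is bounded by `t`. -/
def trialValues (h : DenseForm H) (j : ℕ) : Set ℝ :=
  {t | ∃ f : (Fin j → ℂ) →ₗ[ℂ] h.domain, Function.Injective f ∧
    ∀ x, (h.form (f x) (f x)).re ≤ t * ‖(f x : H)‖ ^ 2}

theorem mem_operator_graph {h : DenseForm H} {u f : H} :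
    (u, f) ∈ h.operator.graph ↔ ∃ hu : u ∈ h.domain, ∀ v : h.domain,
      h.form ⟨u, hu⟩ v = inner ℂ (v : H) f := by
  rw [operator_graph]; rfl

namespace HasCompactResolvent

variable {h : DenseForm H} {c : ℝ} {K : H →L[ℂ] H}

theorem nonneg (hK : h.HasCompactResolvent c K) (u : h.domain) :
    0 ≤ (h.form u u).re + c * ‖(u : H)‖ ^ 2 := by
  rcases eq_or_ne u 0 with rfl | hu
  · simp
  · exact (hK.pos u hu).le

/-- This identifies K as the inverse of A + c. The difference of u and K (f + c u) is annihilated by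
h + c against the whole form domain; testing it against itself and using strict positivity shows
that it vanishes. -/
theorem mem_graph_iff (hK : h.HasCompactResolvent c K) {u f : H} :
    (u, f) ∈ h.operator.graph ↔ u = K (f + (c : ℂ) • u) := by
  rw [mem_operator_graph]
  constructor
  · rintro ⟨hu, huf⟩
    set w : h.domain := ⟨u, hu⟩ - ⟨K (f + (c : ℂ) • u), hK.mem_domain _⟩ with hw
    have key : ∀ v : h.domain, h.form w v + c * inner ℂ (v : H) (w : H) = 0 := by
      intro v
      have h1 := hK.form_add (f + (c : ℂ) • u) v
      rw [hw, map_sub, LinearMap.sub_apply, huf v, Submodule.coe_sub, inner_sub_right]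
      rw [inner_add_right, inner_smul_right] at h1
      linear_combination -h1
    by_contra hne
    have hw0 : w ≠ 0 := fun h0 => hne (by
      have := congrArg (Subtype.val) h0
      simpa [hw, sub_eq_zero] using this)
    have h2 := hK.pos w hw0
    have h3 := congrArg Complex.re (key w)
    rw [inner_self_eq_norm_sq_to_K] at h3
    have h4 : ((c : ℂ) * ((‖(w : H)‖ : ℂ)) ^ 2).re = c * ‖(w : H)‖ ^ 2 := by
      rw [← Complex.ofReal_pow, Complex.re_ofReal_mul, Complex.ofReal_re]
    rw [Complex.add_re] at h3
    simp only [Complex.coe_algebraMap, h4, Complex.zero_re] at h3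
    linarith
  · intro hu
    have hm : u ∈ h.domain := by rw [hu]; exact hK.mem_domain _
    refine ⟨hm, fun v => ?_⟩
    have h1 := hK.form_add (f + (c : ℂ) • u) v
    have : (⟨K (f + (c : ℂ) • u), hK.mem_domain _⟩ : h.domain) = ⟨u, hm⟩ := Subtype.ext hu.symm
    rw [this, ← hu, inner_add_right, inner_smul_right] at h1
    linear_combination h1

theorem isSymmetric (hK : h.HasCompactResolvent c K) : (K : H →ₗ[ℂ] H).IsSymmetric := by
  intro f g
  have h1 := hK.form_add g ⟨K f, hK.mem_domain f⟩
  have h2 := congrArg (starRingEnd ℂ) (hK.form_add f ⟨K g, hK.mem_domain g⟩)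
  simp only [map_add, map_mul, hK.symm, inner_conj_symm, Complex.conj_ofReal] at h2
  change inner ℂ (K f) g = inner ℂ f (K g)
  rw [← h1, ← h2]

theorem injective (hK : h.HasCompactResolvent c K) : Function.Injective K := by
  rw [injective_iff_map_eq_zero]
  intro f hf
  refine h.dense.eq_zero_of_inner_right ℂ fun v hv => ?_
  have h1 := hK.form_add f ⟨v, hv⟩
  have : (⟨K f, hK.mem_domain f⟩ : h.domain) = 0 := Subtype.ext hf
  rw [this, hf] at h1
  simpa using h1.symm

/-- Transfers the spectral theory of compact operators to A. The convention 0⁻¹ = 0 is harmless at z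
= -c: both sides are then trivial, as K is injective. -/
theorem eigenspace_eq (hK : h.HasCompactResolvent c K) (z : ℂ) :
    eigenspace h.operator z = Module.End.eigenspace (K : H →ₗ[ℂ] H) (z + c)⁻¹ := by
  ext u
  have h1 : u ∈ eigenspace h.operator z ↔ (u, z • u) ∈ h.operator.graph := Iff.rfl
  rw [h1, hK.mem_graph_iff, Module.End.mem_eigenspace_iff, ← add_smul, map_smul]
  change u = (z + c) • K u ↔ K u = (z + c)⁻¹ • u
  by_cases hz : z + c = 0
  · rw [hz, inv_zero, zero_smul, zero_smul]
    constructor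
    · rintro rfl; simp
    · intro h; exact hK.injective (by simpa using h)
  · rw [eq_inv_smul_iff₀ hz, eq_comm]

/-- Eigenvalues are real and larger than `-c`. -/
theorem eigenvalue_real (hK : h.HasCompactResolvent c K) {z : ℂ}
    (hz : eigenspace h.operator z ≠ ⊥) : (z.re : ℂ) = z ∧ 0 < z.re + c := by
  obtain ⟨u, hu, hu0⟩ := Submodule.exists_mem_ne_zero_of_ne_bot hz
  have h1 : (u, z • u) ∈ h.operator.graph := hu
  rw [mem_operator_graph] at h1
  obtain ⟨hm, h1⟩ := h1
  have h2 := h1 ⟨u, hm⟩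
  have hw0 : (⟨u, hm⟩ : h.domain) ≠ 0 := fun h0 => hu0 (congrArg Subtype.val h0)
  have hn : 0 < ‖u‖ ^ 2 := by positivity
  rw [inner_smul_right, inner_self_eq_norm_sq_to_K] at h2
  have hreal := hK.symm ⟨u, hm⟩ ⟨u, hm⟩
  have hpos := hK.pos _ hw0
  rw [h2] at hreal hpos
  simp only [Complex.coe_algebraMap, ← Complex.ofReal_pow] at hreal hpos
  rw [map_mul, Complex.conj_ofReal] at hreal
  have hc : starRingEnd ℂ z = z := by
    refine mul_right_cancel₀ ?_ hreal
    exact_mod_cast hn.ne'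
  refine ⟨Complex.conj_eq_iff_re.1 hc, ?_⟩
  rw [Complex.re_mul_ofReal, ← add_mul] at hpos
  exact pos_of_mul_pos_left hpos hn.le

theorem eigenspace_orthogonal (hK : h.HasCompactResolvent c K) {μ ν : ℝ} (hne : μ ≠ ν) {u v : H}
    (hu : u ∈ eigenspace h.operator μ) (hv : v ∈ eigenspace h.operator ν) :
    inner ℂ u v = 0 := by
  rw [hK.eigenspace_eq] at hu hv
  refine hK.isSymmetric.orthogonalFamily_eigenspaces (i := ((μ : ℂ) + c)⁻¹)
    (j := ((ν : ℂ) + c)⁻¹) ?_ ⟨u, hu⟩ ⟨v, hv⟩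
  intro h0
  exact hne (by exact_mod_cast add_right_cancel (inv_injective h0))

/-- The spectral theorem for K: its eigenvectors are total, its kernel is trivial, and an eigenvalue
z ≠ 0 of K corresponds to the real eigenvalue 1/z - c of A. -/
theorem iSup_eigenspace_orthogonal (hK : h.HasCompactResolvent c K) [CompleteSpace H] :
    (⨆ μ : ℝ, eigenspace h.operator (μ : ℂ))ᗮ = ⊥ := by
  rw [eq_bot_iff, ← K.orthogonalComplement_iSup_eigenspaces_eq_bot hK.compact hK.isSymmetric]
  refine Submodule.orthogonal_le (iSup_le fun z => ?_)
  by_cases hz : z = 0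
  · intro u hu
    rw [Module.End.mem_eigenspace_iff, hz, zero_smul] at hu
    have : u = 0 := hK.injective (by simpa using hu)
    rw [this]; exact Submodule.zero_mem _
  · have h1 := hK.eigenspace_eq (z⁻¹ - c)
    rw [sub_add_cancel, inv_inv] at h1
    rw [← h1]
    by_cases hb : eigenspace h.operator (z⁻¹ - c) = ⊥
    · rw [hb]; exact bot_le
    · obtain ⟨hr, -⟩ := hK.eigenvalue_real hb
      rw [← hr]
      exact le_iSup (fun μ : ℝ => eigenspace h.operator (μ : ℂ)) _

/-- Finite orthogonal decompositions into eigenvectors. -/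
theorem exists_sum_eigenvectors (hK : h.HasCompactResolvent c K) (p : ℝ → Prop) {u : H}
    (hu : u ∈ ⨆ μ : ℝ, ⨆ _ : p μ, eigenspace h.operator (μ : ℂ)) :
    ∃ (s : Finset ℝ) (v : ℝ → H), u = ∑ μ ∈ s, v μ ∧
      (∀ μ ∈ s, p μ ∧ 0 < μ + c ∧ v μ ∈ eigenspace h.operator (μ : ℂ)) ∧
      ∀ μ ∈ s, ∀ ν ∈ s, μ ≠ ν → inner ℂ (v μ) (v ν) = 0 := by
  classical
  obtain ⟨f, hf, rfl⟩ := (Submodule.mem_iSup_iff_exists_finsupp _ _).1 hu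
  have key : ∀ μ ∈ f.support, p μ ∧ 0 < μ + c ∧ f μ ∈ eigenspace h.operator (μ : ℂ) := by
    intro μ hμ
    have h1 := hf μ
    have h0 : f μ ≠ 0 := Finsupp.mem_support_iff.1 hμ
    by_cases hp : p μ
    · rw [iSup_pos hp] at h1
      refine ⟨hp, ?_, h1⟩
      simpa using (hK.eigenvalue_real (Submodule.ne_bot_iff _ |>.2 ⟨_, h1, h0⟩)).2
    · rw [iSup_neg hp] at h1
      exact absurd h1 h0
  exact ⟨f.support, f, rfl, key, fun μ hμ ν hν hne =>
    hK.eigenspace_orthogonal hne (key μ hμ).2.2 (key ν hν).2.2⟩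

theorem apply_eigenvector (hK : h.HasCompactResolvent c K) {μ : ℝ} {v : H}
    (hv : v ∈ eigenspace h.operator (μ : ℂ)) : K v = (((μ + c)⁻¹ : ℝ) : ℂ) • v := by
  rw [hK.eigenspace_eq, Module.End.mem_eigenspace_iff] at hv
  push_cast
  exact hv

/-- The form is bounded by `t` on the spectral subspace for `(-∞, t]`. -/
theorem form_le_of_mem_spectralSubspace (hK : h.HasCompactResolvent c K) {t : ℝ} {u : H}
    (hu : u ∈ spectralSubspace h.operator t) :
    ∃ hm : u ∈ h.domain, (h.form ⟨u, hm⟩ ⟨u, hm⟩).re ≤ t * ‖u‖ ^ 2 := by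
  obtain ⟨s, v, rfl, hs, ho⟩ := hK.exists_sum_eigenvectors (fun μ => μ ≤ t) hu
  have hg : (∑ μ ∈ s, v μ, ∑ μ ∈ s, (μ : ℂ) • v μ) ∈ h.operator.graph := by
    have h1 : (∑ μ ∈ s, v μ, ∑ μ ∈ s, (μ : ℂ) • v μ) = ∑ μ ∈ s, (v μ, (μ : ℂ) • v μ) :=
      Prod.ext (by simp [Prod.fst_sum]) (by simp [Prod.snd_sum])
    rw [h1]
    exact Submodule.sum_mem _ fun μ hμ => (hs μ hμ).2.2
  obtain ⟨hm, hform⟩ := mem_operator_graph.1 hg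
  refine ⟨hm, ?_⟩
  rw [hform, inner_sum_smul_of_pairwise_orthogonal s v ho (fun μ => μ), Complex.ofReal_re,
    norm_sq_sum_of_pairwise_orthogonal s v ho, Finset.mul_sum]
  exact Finset.sum_le_sum fun μ hμ => mul_le_mul_of_nonneg_right (hs μ hμ).1 (by positivity)

theorem inner_apply_sum (hK : h.HasCompactResolvent c K) (s : Finset ℝ) (v : ℝ → H)
    (hv : ∀ μ ∈ s, v μ ∈ eigenspace h.operator (μ : ℂ))
    (ho : ∀ μ ∈ s, ∀ ν ∈ s, μ ≠ ν → inner ℂ (v μ) (v ν) = 0) :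
    (inner ℂ (∑ μ ∈ s, v μ) (K (∑ μ ∈ s, v μ))).re = ∑ μ ∈ s, (μ + c)⁻¹ * ‖v μ‖ ^ 2 := by
  rw [map_sum, Finset.sum_congr rfl fun μ hμ => hK.apply_eigenvector (hv μ hμ),
    inner_sum_smul_of_pairwise_orthogonal s v ho (fun μ => (μ + c)⁻¹), Complex.ofReal_re]

/-- The form bound rephrased for K. As K is bounded, this version, unlike the one for the form,
passes to closures of spectral subspaces. -/
theorem le_inner_of_mem_spectralSubspace (hK : h.HasCompactResolvent c K) {t : ℝ} {u : H}
    (hu : u ∈ spectralSubspace h.operator t) :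
    (t + c)⁻¹ * ‖u‖ ^ 2 ≤ (inner ℂ u (K u)).re := by
  obtain ⟨s, v, rfl, hs, ho⟩ := hK.exists_sum_eigenvectors (fun μ => μ ≤ t) hu
  rw [hK.inner_apply_sum s v (fun μ hμ => (hs μ hμ).2.2) ho,
    norm_sq_sum_of_pairwise_orthogonal s v ho, Finset.mul_sum]
  refine Finset.sum_le_sum fun μ hμ => mul_le_mul_of_nonneg_right ?_ (by positivity)
  exact inv_anti₀ (hs μ hμ).2.1 (by linarith [(hs μ hμ).1])

theorem spectralSubspace_eq_bot (hK : h.HasCompactResolvent c K) {t : ℝ} (ht : t + c ≤ 0) :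
    spectralSubspace h.operator t = ⊥ := by
  refine iSup₂_eq_bot.2 fun μ hμ => ?_
  by_contra hb
  have := (hK.eigenvalue_real hb).2
  rw [Complex.ofReal_re] at this
  linarith

theorem operator_isSymmetric (hK : h.HasCompactResolvent c K) :
    h.operator.IsFormalAdjoint h.operator := by
  intro x y
  obtain ⟨hx, hx'⟩ := mem_operator_graph.1 (h.operator.mem_graph x)
  obtain ⟨hy, hy'⟩ := mem_operator_graph.1 (h.operator.mem_graph y)
  rw [← hy' ⟨x, hx⟩, ← inner_conj_symm, ← hx' ⟨y, hy⟩, hK.symm]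

/-- The easy half of min-max: a spectral subspace is itself a trial space. -/
theorem mem_trialValues_of_le_rank (hK : h.HasCompactResolvent c K) {j : ℕ} {t : ℝ}
    (ht : (j : Cardinal) ≤ Module.rank ℂ (spectralSubspace h.operator t)) :
    t ∈ h.trialValues j := by
  obtain ⟨f, hf⟩ := Module.le_rank_iff_exists_linearMap.1 ht
  have hle : spectralSubspace h.operator t ≤ h.domain := fun u hu =>
    (hK.form_le_of_mem_spectralSubspace hu).1
  refine ⟨(Submodule.inclusion hle).comp f, (Submodule.inclusion_injective hle).comp hf,
    fun x => ?_⟩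
  exact (hK.form_le_of_mem_spectralSubspace (f x).2).2

theorem le_of_mem_trialValues (hK : h.HasCompactResolvent c K) {j : ℕ} (hj : 1 ≤ j) {t : ℝ}
    (ht : t ∈ h.trialValues j) : -c ≤ t := by
  obtain ⟨f, hf, hft⟩ := ht
  have : Nonempty (Fin j) := ⟨⟨0, hj⟩⟩
  obtain ⟨x, hx⟩ := exists_ne (0 : Fin j → ℂ)
  have hfx : ((f x : h.domain) : H) ≠ 0 := fun h0 => hx (hf (by
    rw [map_zero]; exact Subtype.ext h0))
  have : 0 < ‖((f x : h.domain) : H)‖ ^ 2 := by positivity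
  have h1 := hK.nonneg (f x)
  nlinarith [hft x]

/-! ### Discreteness of the spectrum, self-adjointness and the min-max principle -/

variable [CompleteSpace H]

/-- Spectral subspaces for half lines `(-∞, t]` are finite dimensional. -/
theorem finiteDimensional_spectralSubspace (hK : h.HasCompactResolvent c K) (t : ℝ) :
    FiniteDimensional ℂ (spectralSubspace h.operator t) := by
  rcases le_or_gt (t + c) 0 with ht | ht
  · rw [hK.spectralSubspace_eq_bot ht]; infer_instance
  set N := spectralSubspace h.operator t with hN
  set M := N.topologicalClosure with hM
  have hinv : ∀ u ∈ N, K u ∈ N := by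
    intro u hu
    refine (?_ : N ≤ N.comap (K : H →ₗ[ℂ] H)) hu
    refine iSup₂_le fun μ hμ v hv => ?_
    change K v ∈ N
    rw [hK.apply_eigenvector hv]
    exact N.smul_mem _ (eigenspace_le_spectralSubspace _ hμ hv)
  have hinvM : ∀ u ∈ M, K u ∈ M := by
    intro u hu
    exact map_mem_closure K.continuous hu hinv
  have hlow : ∀ u ∈ M, (t + c)⁻¹ * ‖u‖ ^ 2 ≤ (inner ℂ u (K u)).re := by
    intro u hu
    have hcl : IsClosed {u : H | (t + c)⁻¹ * ‖u‖ ^ 2 ≤ (inner ℂ u (K u)).re} :=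
      isClosed_le (by fun_prop) (Complex.continuous_re.comp (by fun_prop))
    exact closure_minimal (fun u hu => hK.le_inner_of_mem_spectralSubspace hu) hcl hu
  have : CompleteSpace M := N.isClosed_topologicalClosure.completeSpace_coe
  let S : M →L[ℂ] M := K.restrict hinvM
  have hS : IsCompactOperator S := hK.compact.restrict' hinvM
  have hpos : 0 < (t + c)⁻¹ := inv_pos.2 ht
  -- K restricted to the closed invariant subspace M is bounded below as a quadratic form, hence
  -- invertible. Being also compact, it makes the identity of M compact, which forces M to be finite
  -- dimensional.
  have hunit : IsUnit S := by
    refine S.isUnit_of_forall_le_norm_inner_map (c := ⟨(t + c)⁻¹, hpos.le⟩) hpos fun u => ?_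
    rw [← inner_conj_symm, RCLike.norm_conj]
    have h1 := hlow u u.2
    calc ‖u‖ ^ 2 * (t + c)⁻¹ ≤ (inner ℂ (u : H) (K u)).re := by rw [mul_comm]; exact h1
      _ ≤ ‖inner ℂ (u : H) (K u)‖ := Complex.re_le_norm _
  obtain ⟨w, hw⟩ := hunit
  have hid : IsCompactOperator (_root_.id : M → M) := by
    have h1 := hS.clm_comp (↑w⁻¹ : M →L[ℂ] M)
    have h2 : ((↑w⁻¹ : M →L[ℂ] M) : M → M) ∘ S = _root_.id := by
      funext u
      have := congrArg (fun T : M →L[ℂ] M => T u) w.inv_mul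
      rw [hw] at this
      exact this
    rwa [h2] at h1
  have : FiniteDimensional ℂ M := FiniteDimensional.of_isCompactOperator_id hid
  exact Submodule.finiteDimensional_of_le N.le_topologicalClosure

/-- The form is bounded below by `t` on the orthogonal complement of the spectral subspace for
`(-∞, t]`. -/
theorem le_form_of_mem_orthogonal (hK : h.HasCompactResolvent c K) {t : ℝ} (u : h.domain)
    (hu : (u : H) ∈ (spectralSubspace h.operator t)ᗮ) :
    t * ‖(u : H)‖ ^ 2 ≤ (h.form u u).re := by
  rcases le_or_gt (t + c) 0 with ht | ht
  · have := hK.nonneg u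
    nlinarith [sq_nonneg ‖(u : H)‖]
  set N := spectralSubspace h.operator t with hN
  set P : Submodule ℂ H := ⨆ μ : ℝ, ⨆ _ : t < μ, eigenspace h.operator (μ : ℂ) with hP
  have hPN : P ⟂ N := by
    simp only [hP, hN, spectralSubspace, Submodule.isOrtho_iSup_left,
      Submodule.isOrtho_iSup_right]
    intro μ hμ ν hν
    rw [Submodule.isOrtho_iff_inner_eq]
    intro v hv w hw
    exact hK.eigenspace_orthogonal (by linarith : μ < ν).ne' hv hw
  have := hK.finiteDimensional_spectralSubspace t
  rw [← hN] at this
  have hbot : Nᗮ ⊓ Pᗮ = ⊥ := by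
    rw [Submodule.inf_orthogonal, eq_bot_iff, ← hK.iSup_eigenspace_orthogonal]
    refine Submodule.orthogonal_le (iSup_le fun μ => ?_)
    rcases le_or_gt μ t with hμ | hμ
    · exact (eigenspace_le_spectralSubspace _ hμ).trans le_sup_left
    · exact (le_iSup₂_of_le (f := fun (μ : ℝ) (_ : t < μ) => eigenspace h.operator (μ : ℂ))
        μ hμ le_rfl).trans le_sup_right
  -- All eigenvectors lie in N or P, so N and P together are total. As N is finite dimensional,
  -- projection onto N is available and shows that nothing else is orthogonal to P.
  have hP' : Pᗮ ≤ N := by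
    intro w hw
    have h1 : w - N.starProjection w ∈ Nᗮ ⊓ Pᗮ :=
      ⟨N.sub_starProjection_mem_orthogonal w,
        Pᗮ.sub_mem hw (hPN.symm (N.starProjection_apply_mem w))⟩
    rw [hbot, Submodule.mem_bot, sub_eq_zero] at h1
    rw [h1]
    exact N.starProjection_apply_mem w
  have hucl : (u : H) ∈ P.topologicalClosure := by
    rw [← Submodule.orthogonal_orthogonal_eq_closure]
    exact Submodule.orthogonal_le hP' hu
  have hup : (inner ℂ (u : H) (K u)).re ≤ (t + c)⁻¹ * ‖(u : H)‖ ^ 2 := by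
    have hcl : IsClosed {u : H | (inner ℂ u (K u)).re ≤ (t + c)⁻¹ * ‖u‖ ^ 2} :=
      isClosed_le (Complex.continuous_re.comp (by fun_prop)) (by fun_prop)
    refine closure_minimal (fun w hw => ?_) hcl hucl
    obtain ⟨s, v, rfl, hs, ho⟩ := hK.exists_sum_eigenvectors (fun μ => t < μ) hw
    change (inner ℂ (∑ μ ∈ s, v μ) (K (∑ μ ∈ s, v μ))).re ≤ (t + c)⁻¹ * ‖∑ μ ∈ s, v μ‖ ^ 2
    rw [hK.inner_apply_sum s v (fun μ hμ => (hs μ hμ).2.2) ho,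
      norm_sq_sum_of_pairwise_orthogonal s v ho, Finset.mul_sum]
    refine Finset.sum_le_sum fun μ hμ => mul_le_mul_of_nonneg_right ?_ (by positivity)
    exact inv_anti₀ ht (by linarith [(hs μ hμ).1])
  -- Back from K to the form: expanding (h + c)[u - k, u - k] ≥ 0 for k = (t + c) K u gives (h +
  -- c)[u, u] ≥ 2 (t + c)‖u‖² - (t + c)² (u, K u), and `hup` bounds the last term. The factor t + c
  -- is the one for which k = u when u is an eigenvector at t.
  set f : H := ((t + c : ℝ) : ℂ) • (u : H) with hf
  set k : h.domain := ⟨K f, hK.mem_domain f⟩ with hk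
  have hnn := hK.nonneg (u - k)
  have e1 := congrArg Complex.re (hK.form_add f u)
  have e2 := congrArg Complex.re (hK.form_add f k)
  have e3 : (h.form u k).re = (h.form k u).re := by
    rw [← hK.symm k u, Complex.conj_re]
  have e4 : ‖((u - k : h.domain) : H)‖ ^ 2
      = ‖(u : H)‖ ^ 2 - 2 * (inner ℂ (u : H) (K f)).re + ‖(k : H)‖ ^ 2 := by
    rw [Submodule.coe_sub, @norm_sub_sq ℂ]
    rfl
  have e5 : (inner ℂ (k : H) (K f)).re = ‖(k : H)‖ ^ 2 := by
    rw [← Complex.ofReal_re (‖(k : H)‖ ^ 2), Complex.ofReal_pow]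
    exact congrArg Complex.re (inner_self_eq_norm_sq_to_K (𝕜 := ℂ) (K f))
  have e6 : (inner ℂ (u : H) f).re = (t + c) * ‖(u : H)‖ ^ 2 := by
    rw [hf, inner_smul_right, Complex.re_ofReal_mul, ← inner_self_eq_norm_sq (𝕜 := ℂ)]
    rfl
  have e7 : (inner ℂ (k : H) f).re = (t + c) ^ 2 * (inner ℂ (u : H) (K u)).re := by
    rw [hk]
    change (inner ℂ (K f) f).re = _
    rw [hf, map_smul, inner_smul_left, inner_smul_right, Complex.conj_ofReal,
      Complex.re_ofReal_mul, Complex.re_ofReal_mul, ← inner_conj_symm, Complex.conj_re]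
    ring
  simp only [Complex.add_re, Complex.re_ofReal_mul] at e1 e2
  rw [map_sub, map_sub, LinearMap.sub_apply, LinearMap.sub_apply, Complex.sub_re, Complex.sub_re,
    Complex.sub_re, e3, e4] at hnn
  rw [e5, e7] at e2
  rw [e6] at e1
  have h3 : (t + c) ^ 2 * (inner ℂ (u : H) (K u)).re ≤ (t + c) * ‖(u : H)‖ ^ 2 := by
    calc _ ≤ (t + c) ^ 2 * ((t + c)⁻¹ * ‖(u : H)‖ ^ 2) := by gcongr
      _ = _ := by field_simp
  linarith

/-- The Fredholm alternative for K at 1/(z + c). The resolvent R is characterised by R f = K (f + (z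
+ c) R f). -/
theorem eigenspace_ne_bot_of_mem_spectrum (hK : h.HasCompactResolvent c K) {z : ℂ}
    (hz : z ∈ spectrum h.operator) : eigenspace h.operator z ≠ ⊥ := by
  intro hb
  have hR : ∃ R : H →L[ℂ] H, (∀ f, R f = K (f + (z + c) • R f)) ∧
      ∀ u f, u = K (f + (z + c) • u) → R f = u := by
    by_cases h0 : z + c = 0
    · exact ⟨K, by simp [h0], fun u f hu => by simpa [h0] using hu.symm⟩
    · have h1 := hK.compact.hasEigenvalue_or_mem_resolventSet (μ := (z + c)⁻¹) (inv_ne_zero h0)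
      rcases h1 with h1 | h1
      · exact absurd ((hK.eigenspace_eq z).symm.trans hb) h1
      · obtain ⟨w, hw⟩ := h1
        have hwu : ∀ u, (w : H →L[ℂ] H) u = (z + c)⁻¹ • u - K u := by
          intro u; rw [hw]; rfl
        have hi : ∀ u, (↑w⁻¹ : H →L[ℂ] H) ((w : H →L[ℂ] H) u) = u := fun u =>
          congrArg (fun T : H →L[ℂ] H => T u) w.inv_mul
        have hi' : ∀ u, (w : H →L[ℂ] H) ((↑w⁻¹ : H →L[ℂ] H) u) = u := fun u =>
          congrArg (fun T : H →L[ℂ] H => T u) w.mul_inv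
        -- Solving R f = K f + (z + c) K R f for R f, where w is (z + c)⁻¹ - K.
        refine ⟨(z + c)⁻¹ • (↑w⁻¹ : H →L[ℂ] H).comp K, fun f => ?_, fun u f hu => ?_⟩
        · have h2 := hi' (K f)
          rw [hwu] at h2
          simp only [smul_apply, ContinuousLinearMap.comp_apply, map_add,
            smul_smul, mul_inv_cancel₀ h0, one_smul]
          exact sub_eq_iff_eq_add.1 h2
        · have h2 : K f = (z + c) • (w : H →L[ℂ] H) u := by
            rw [hwu, smul_sub, smul_smul, mul_inv_cancel₀ h0, one_smul, eq_sub_iff_add_eq,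
              ← map_smul, ← map_add]
            exact hu.symm
          simp only [smul_apply, ContinuousLinearMap.comp_apply, h2, map_smul,
            hi, smul_smul, inv_mul_cancel₀ h0, one_smul]
  obtain ⟨R, hR1, hR2⟩ := hR
  refine hz ⟨R, fun f => ?_, fun u => ?_⟩
  · have : (R f, f + z • R f) ∈ h.operator.graph := by
      rw [hK.mem_graph_iff, add_assoc, ← add_smul]
      exact hR1 f
    rw [LinearPMap.mem_graph_iff] at this
    obtain ⟨y, hy, hy'⟩ := this
    have hm : R f ∈ h.operator.domain := by rw [← show (y : H) = R f from hy]; exact y.2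
    refine ⟨hm, ?_⟩
    have : (⟨R f, hm⟩ : h.operator.domain) = y := Subtype.ext hy.symm
    rw [this, hy']
    simp
  · refine hR2 _ _ ?_
    have : ((u : H), h.operator u) ∈ h.operator.graph := h.operator.mem_graph u
    rw [hK.mem_graph_iff] at this
    rwa [add_smul, ← add_assoc, sub_add_cancel]

theorem dense_operator_domain (hK : h.HasCompactResolvent c K) :
    Dense (h.operator.domain : Set H) := by
  rw [Submodule.dense_iff_topologicalClosure_eq_top, Submodule.topologicalClosure_eq_top_iff,
    eq_bot_iff, ← hK.iSup_eigenspace_orthogonal]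
  refine Submodule.orthogonal_le (iSup_le fun μ u hu => ?_)
  exact (mem_eigenspace.1 hu).1

theorem isSelfAdjoint_operator (hK : h.HasCompactResolvent c K) :
    IsSelfAdjoint h.operator := by
  rw [LinearPMap.isSelfAdjoint_def]
  refine le_antisymm ?_ (hK.operator_isSymmetric.le_adjoint hK.dense_operator_domain)
  rw [← LinearPMap.le_graph_iff]
  rintro ⟨u, g⟩ hug
  rw [LinearPMap.mem_graph_iff] at hug
  obtain ⟨y, hy, hy'⟩ := hug
  simp only at hy hy'
  rw [hK.mem_graph_iff]
  refine ext_inner_right ℂ fun f => ?_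
  -- For arbitrary f, K f is a domain vector with image f - c K f. Pairing the adjoint relation with
  -- it and moving K across by symmetry gives u = K (g + c u).
  have hmem : (K f, f - (c : ℂ) • K f) ∈ h.operator.graph := by
    rw [hK.mem_graph_iff, sub_add_cancel]
  obtain ⟨x, hxx, hx'⟩ := (LinearPMap.mem_graph_iff _).1 hmem
  simp only at hxx hx'
  have h1 := LinearPMap.adjoint_isFormalAdjoint hK.dense_operator_domain y x
  rw [hy, hy', hxx, hx', inner_sub_right, inner_smul_right] at h1
  have h2 := hK.isSymmetric (g + (c : ℂ) • u) f
  change inner ℂ (K (g + (c : ℂ) • u)) f = inner ℂ (g + (c : ℂ) • u) (K f) at h2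
  rw [h2, inner_add_left, inner_smul_left, Complex.conj_ofReal]
  linear_combination -h1

/-- Eigenvectors for distinct eigenvalues are orthogonal, and those for eigenvalues up to t share a
finite dimensional space. -/
theorem finite_eigenvalues_le (hK : h.HasCompactResolvent c K) (t : ℝ) :
    {μ : ℝ | μ ≤ t ∧ eigenspace h.operator (μ : ℂ) ≠ ⊥}.Finite := by
  have hfd := hK.finiteDimensional_spectralSubspace t
  have hex : ∀ μ : {μ : ℝ | μ ≤ t ∧ eigenspace h.operator (μ : ℂ) ≠ ⊥},
      ∃ v : spectralSubspace h.operator t, (v : H) ∈ eigenspace h.operator ((μ : ℝ) : ℂ) ∧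
        v ≠ 0 := by
    rintro ⟨μ, hμ, hb⟩
    obtain ⟨u, hu, hu0⟩ := Submodule.exists_mem_ne_zero_of_ne_bot hb
    exact ⟨⟨u, eigenspace_le_spectralSubspace _ hμ hu⟩, hu,
      fun h0 => hu0 (congrArg Subtype.val h0)⟩
  choose v hv hv0 using hex
  have hli : LinearIndependent ℂ v := linearIndependent_of_ne_zero_of_inner_eq_zero hv0
    fun μ ν hne => hK.eigenspace_orthogonal (fun h0 => hne (Subtype.ext h0)) (hv μ) (hv ν)
  exact Set.finite_coe_iff.1 hli.finite_of_isNoetherian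

theorem hasPurelyDiscreteSpectrum (hK : h.HasCompactResolvent c K)
    (hinf : ¬ FiniteDimensional ℂ H) : HasPurelyDiscreteSpectrum h.operator where
  isolated z _ hacc := by
    have hU : {w : ℂ | w.re < z.re + 1} ∈ 𝓝 z :=
      (isOpen_lt Complex.continuous_re continuous_const).mem_nhds (by simp)
    refine Set.Infinite.of_accPt (hacc.nhds_inter hU) ?_
    refine ((hK.finite_eigenvalues_le (z.re + 1)).image (fun t : ℝ => (t : ℂ))).subset ?_
    rintro w ⟨hw1, hw2⟩
    have hb := hK.eigenspace_ne_bot_of_mem_spectrum hw2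
    have hr := (hK.eigenvalue_real hb).1
    exact ⟨w.re, ⟨le_of_lt hw1, by rwa [hr]⟩, hr⟩
  isEigenvalue z hz := hK.eigenspace_ne_bot_of_mem_spectrum hz
  finiteDimensional z hz := by
    have hr := (hK.eigenvalue_real (hK.eigenspace_ne_bot_of_mem_spectrum hz)).1
    have := hK.finiteDimensional_spectralSubspace z.re
    rw [← hr]
    exact Submodule.finiteDimensional_of_le (eigenspace_le_spectralSubspace _ le_rfl)
  bddBelow := by
    refine ⟨-c, fun t ht => ?_⟩
    have := (hK.eigenvalue_real (hK.eigenspace_ne_bot_of_mem_spectrum ht)).2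
    rw [Complex.ofReal_re] at this
    linarith
  not_bddAbove := by
    rintro ⟨t, ht⟩
    have hfd := hK.finiteDimensional_spectralSubspace t
    -- If the spectrum were bounded by t, one finite dimensional, hence closed, spectral subspace
    -- would contain the total set of eigenvectors and so be all of H.
    have hle : ⨆ μ : ℝ, eigenspace h.operator (μ : ℂ) ≤ spectralSubspace h.operator t := by
      refine iSup_le fun μ => ?_
      by_cases hb : eigenspace h.operator (μ : ℂ) = ⊥
      · rw [hb]; exact bot_le
      · exact eigenspace_le_spectralSubspace _ (ht (mem_spectrum_of_eigenspace_ne_bot hb))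
    have h1 := Submodule.orthogonal_le hle
    rw [hK.iSup_eigenspace_orthogonal, le_bot_iff, Submodule.orthogonal_eq_bot_iff] at h1
    rw [h1] at hfd
    exact hinf (Module.Finite.equiv (Submodule.topEquiv (R := ℂ) (M := H)))

/-- The hard half of min-max. A trial space of dimension larger than that of the spectral subspace
contains a nonzero vector orthogonal to it, where the form is at least t‖u‖². The strict inequality
s < t is what produces the contradiction. -/
theorem le_rank_of_mem_trialValues (hK : h.HasCompactResolvent c K) {j : ℕ} {s t : ℝ}
    (hs : s ∈ h.trialValues j) (hst : s < t) :
    (j : Cardinal) ≤ Module.rank ℂ (spectralSubspace h.operator t) := by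
  obtain ⟨f, hf, hfs⟩ := hs
  set N := spectralSubspace h.operator t with hN
  have hfd : FiniteDimensional ℂ N := hK.finiteDimensional_spectralSubspace t
  by_contra hlt
  rw [not_le, ← Module.finrank_eq_rank, Nat.cast_lt] at hlt
  let g : (Fin j → ℂ) →ₗ[ℂ] N :=
    (N.orthogonalProjectionOnto : H →ₗ[ℂ] N).comp (h.domain.subtype.comp f)
  have hker : LinearMap.ker g ≠ ⊥ := LinearMap.ker_ne_bot_of_finrank_lt (by simpa using hlt)
  obtain ⟨x, hx, hx0⟩ := Submodule.exists_mem_ne_zero_of_ne_bot hker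
  have hmem : ((f x : h.domain) : H) ∈ Nᗮ := by
    rw [← Submodule.orthogonalProjectionOnto_eq_zero_iff]
    exact hx
  have h1 := hK.le_form_of_mem_orthogonal (f x) hmem
  have hfx : ((f x : h.domain) : H) ≠ 0 := fun h0 => hx0 (hf (by
    rw [map_zero]; exact Subtype.ext h0))
  have : 0 < ‖((f x : h.domain) : H)‖ ^ 2 := by positivity
  nlinarith [hfs x]

theorem trialValues_nonempty (hK : h.HasCompactResolvent c K)
    (hinf : ¬ FiniteDimensional ℂ H) (j : ℕ) : (h.trialValues j).Nonempty := by
  have hnb := (hK.hasPurelyDiscreteSpectrum hinf).not_bddAbove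
  have hS : {t : ℝ | (t : ℂ) ∈ spectrum h.operator}.Infinite := fun hfin => hnb hfin.bddAbove
  obtain ⟨F, hF, hcard⟩ := hS.exists_subset_card_eq j
  obtain ⟨t, ht⟩ := F.finite_toSet.bddAbove
  refine ⟨t, hK.mem_trialValues_of_le_rank ?_⟩
  have hex : ∀ μ : F, ∃ v : spectralSubspace h.operator t,
      (v : H) ∈ eigenspace h.operator ((μ : ℝ) : ℂ) ∧ v ≠ 0 := by
    rintro ⟨μ, hμ⟩
    obtain ⟨u, hu, hu0⟩ := Submodule.exists_mem_ne_zero_of_ne_bot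
      (hK.eigenspace_ne_bot_of_mem_spectrum (hF hμ))
    exact ⟨⟨u, eigenspace_le_spectralSubspace _ (ht hμ) hu⟩, hu,
      fun h0 => hu0 (congrArg Subtype.val h0)⟩
  choose v hv hv0 using hex
  have hli : LinearIndependent ℂ v := linearIndependent_of_ne_zero_of_inner_eq_zero hv0
    fun μ ν hne => hK.eigenspace_orthogonal (fun h0 => hne (Subtype.ext h0)) (hv μ) (hv ν)
  have := hli.cardinal_lift_le_rank
  simpa [hcard] using this

/-- The variational characterisation of eigenvalues. -/
theorem nthEigenvalue_eq_sInf_trialValues (hK : h.HasCompactResolvent c K)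
    (hinf : ¬ FiniteDimensional ℂ H) {j : ℕ} (hj : 1 ≤ j) :
    nthEigenvalue h.operator j = sInf (h.trialValues j) := by
  have hbdd : BddBelow (h.trialValues j) := ⟨-c, fun t ht => hK.le_of_mem_trialValues hj ht⟩
  have hsub : {t : ℝ | (j : Cardinal) ≤ Module.rank ℂ (spectralSubspace h.operator t)} ⊆
      h.trialValues j := fun t ht => hK.mem_trialValues_of_le_rank ht
  obtain ⟨s, hs⟩ := hK.trialValues_nonempty hinf j
  rw [nthEigenvalue_eq]
  refine le_antisymm (le_csInf ⟨s, hs⟩ fun b hb => ?_)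
    (csInf_le_csInf hbdd ⟨s + 1, hK.le_rank_of_mem_trialValues hs (by linarith)⟩ hsub)
  refine le_of_forall_pos_le_add fun ε hε => csInf_le (hbdd.mono hsub) ?_
  exact hK.le_rank_of_mem_trialValues hb (by linarith)

end HasCompactResolvent

end DenseForm

end UnboundedOp

/-! ### Compact resolvents from coercive forms -/

namespace UnboundedOp.DenseForm

variable {H : Type*} [NormedAddCommGroup H] [InnerProductSpace ℂ H] [CompleteSpace H]
  {V : Type*} [NormedAddCommGroup V] [InnerProductSpace ℂ V] [CompleteSpace V]

/-- A symmetric form which is bounded and coercive, up to a multiple of the norm of `H`, on a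
Hilbert space compactly embedded in `H` has compact resolvent. -/
theorem exists_hasCompactResolvent (h : DenseForm H) (J : V →L[ℂ] H) (hJ : IsCompactOperator J)
    (hJm : ∀ u, J u ∈ h.domain) (hJs : ∀ w : h.domain, ∃ u, J u = w)
    (T : V →L[ℂ] V) (hT : (T : V →ₗ[ℂ] V).IsSymmetric)
    (hform : ∀ u v, h.form ⟨J u, hJm u⟩ ⟨J v, hJm v⟩ = inner ℂ v (T u))
    {c ε : ℝ} (hε : 0 < ε)
    (hcoer : ∀ u, ε * ‖u‖ ^ 2 ≤ (inner ℂ u (T u)).re + c * ‖J u‖ ^ 2) :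
    ∃ K : H →L[ℂ] H, h.HasCompactResolvent c K := by
  set B : V →L[ℂ] V := T + (c : ℂ) • (J.adjoint.comp J) with hB
  have hBin : ∀ u v, inner ℂ v (B u) = inner ℂ v (T u) + c * inner ℂ (J v) (J u) := by
    intro u v
    simp [hB, ContinuousLinearMap.adjoint_inner_right]
  have hBre : ∀ u, (inner ℂ u (B u)).re = (inner ℂ u (T u)).re + c * ‖J u‖ ^ 2 := by
    intro u
    rw [hBin, Complex.add_re, Complex.re_ofReal_mul, ← inner_self_eq_norm_sq (𝕜 := ℂ)]
    rfl
  have hunit : IsUnit B := by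
    refine B.isUnit_of_forall_le_norm_inner_map (c := ⟨ε, hε.le⟩) hε fun u => ?_
    rw [← inner_conj_symm, RCLike.norm_conj]
    calc ‖u‖ ^ 2 * ε ≤ (inner ℂ u (B u)).re := by rw [mul_comm, hBre]; exact hcoer u
      _ ≤ ‖inner ℂ u (B u)‖ := Complex.re_le_norm _
  obtain ⟨w, hw⟩ := hunit
  have hi : ∀ u, B ((↑w⁻¹ : V →L[ℂ] V) u) = u := fun u => by
    rw [← hw]; exact congrArg (fun T : V →L[ℂ] V => T u) w.mul_inv
  -- The Lax-Milgram solution: B represents h + c on V, and (f, J v) = (J* f, v), so the resolvent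
  -- is J B⁻¹ J*, compact because J is.
  refine ⟨J.comp ((↑w⁻¹ : V →L[ℂ] V).comp J.adjoint), ?_, ?_, ?_, fun f => hJm _, ?_⟩
  · intro u v
    obtain ⟨u, hu⟩ := u
    obtain ⟨v, hv⟩ := v
    obtain ⟨u', rfl⟩ := hJs ⟨u, hu⟩
    obtain ⟨v', rfl⟩ := hJs ⟨v, hv⟩
    rw [hform, hform, inner_conj_symm]
    exact hT u' v'
  · intro u hu0
    obtain ⟨u, hu⟩ := u
    obtain ⟨u', rfl⟩ := hJs ⟨u, hu⟩
    have hu' : u' ≠ 0 := by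
      rintro rfl
      exact hu0 (Subtype.ext (map_zero J))
    rw [hform]
    have : 0 < ε * ‖u'‖ ^ 2 := by positivity
    exact this.trans_le (hcoer u')
  · exact hJ.comp_clm ((↑w⁻¹ : V →L[ℂ] V).comp J.adjoint)
  · intro f v
    obtain ⟨v, hv⟩ := v
    obtain ⟨v', rfl⟩ := hJs ⟨v, hv⟩
    refine Eq.trans ?_ (ContinuousLinearMap.adjoint_inner_right J v' f)
    rw [← hi (J.adjoint f), hBin]
    exact congrArg₂ (· + ·) (hform _ v') rfl

end UnboundedOp.DenseForm

/-! ### Compactness by finite-rank approximation and operators of forms -/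

/-- An operator which is small on the common kernel of finitely many continuous functionals, up to
an arbitrarily small error, is compact. -/
theorem isCompactOperator_of_small_on_ker {V H : Type*} [NormedAddCommGroup V]
    [InnerProductSpace ℂ V] [CompleteSpace V] [NormedAddCommGroup H] [InnerProductSpace ℂ H]
    [CompleteSpace H] (J : V →L[ℂ] H)
    (hJ : ∀ ε : ℝ, 0 < ε → ∃ (n : ℕ) (F : V →L[ℂ] (Fin n → ℂ)),
      ∀ u, F u = 0 → ‖J u‖ ≤ ε * ‖u‖) : IsCompactOperator J := by
  have hcl := isClosed_setOfPred_isCompactOperator (𝕜₁ := ℂ) (𝕜₂ := ℂ) (σ₁₂ := RingHom.id ℂ)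
    (M₁ := V) (M₂ := H)
  refine hcl.closure_subset (Metric.mem_closure_iff.2 fun ε hε => ?_)
  obtain ⟨n, F, hF⟩ := hJ (ε / 2) (by linarith)
  set N : Submodule ℂ V := LinearMap.ker (F : V →ₗ[ℂ] (Fin n → ℂ)) with hN
  have hNc : IsClosed (N : Set V) := F.isClosed_ker
  have : CompleteSpace N := hNc.completeSpace_coe
  have hfd : FiniteDimensional ℂ Nᗮ := by
    refine FiniteDimensional.of_injective ((F : V →ₗ[ℂ] (Fin n → ℂ)).comp Nᗮ.subtype) ?_
    rw [← LinearMap.ker_eq_bot, LinearMap.ker_eq_bot']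
    intro u hu
    have h1 : (u : V) ∈ N := hu
    have h2 : (u : V) ∈ N ⊓ Nᗮ := ⟨h1, u.2⟩
    rw [Submodule.inf_orthogonal_eq_bot, Submodule.mem_bot] at h2
    exact Subtype.ext h2
  -- The approximant is J cut off to the orthogonal complement of ker F, which is finite dimensional
  -- because F is injective there. The error is J composed with the projection onto ker F, where J
  -- is small.
  refine ⟨J.comp (Nᗮ.subtypeL.comp Nᗮ.orthogonalProjectionOnto), ?_, ?_⟩
  · have h1 : IsCompactOperator (J.comp Nᗮ.subtypeL) := by
      have := LocallyCompactSpace.of_finiteDimensional_of_complete ℂ Nᗮ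
      exact isCompactOperator_of_locallyCompactSpace_rng (J.comp Nᗮ.subtypeL)
    exact h1.comp_clm Nᗮ.orthogonalProjectionOnto
  · rw [dist_eq_norm]
    refine lt_of_le_of_lt (ContinuousLinearMap.opNorm_le_bound _ (half_pos hε).le fun u => ?_)
      (half_lt_self hε)
    have h1 : (J - J.comp (Nᗮ.subtypeL.comp Nᗮ.orthogonalProjectionOnto)) u
        = J (N.starProjection u) := by
      have h2 := congrArg J (N.starProjection_add_starProjection_orthogonal u)
      rw [map_add] at h2
      exact sub_eq_of_eq_add h2.symm
    rw [h1]
    have h2 : F (N.starProjection u) = 0 := N.starProjection_apply_mem u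
    refine (hF _ h2).trans ?_
    gcongr
    exact N.norm_starProjection_apply_le u

/-- The operator of a form which is a sum of rank one forms and the pullback of an inner product. -/
theorem exists_isSymmetric_of_form {V H ι : Type*} [NormedAddCommGroup V] [InnerProductSpace ℂ V]
    [CompleteSpace V] [NormedAddCommGroup H] [InnerProductSpace ℂ H] [CompleteSpace H] [Fintype ι]
    (G : V →L[ℂ] H) (e : ι → V →L[ℂ] ℂ) (γ : ι → ℝ) :
    ∃ T : V →L[ℂ] V, (T : V →ₗ[ℂ] V).IsSymmetric ∧ ∀ u v, inner ℂ v (T u)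
      = inner ℂ (G v) (G u) + ∑ i, γ i * (e i u * starRingEnd ℂ (e i v)) := by
  let T : V →L[ℂ] V := G.adjoint.comp G + ∑ i, (γ i : ℂ) • (e i).adjoint.comp (e i)
  have hT : ∀ u v, inner ℂ v (T u)
      = inner ℂ (G v) (G u) + ∑ i, γ i * (e i u * starRingEnd ℂ (e i v)) := by
    intro u v
    simp [T, ContinuousLinearMap.adjoint_inner_right]
  refine ⟨T, fun u v => ?_, hT⟩
  change inner ℂ (T u) v = inner ℂ u (T v)
  rw [← inner_conj_symm, hT, hT]
  simp [mul_comm]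

/-! ### Sobolev estimates on a bounded interval -/

namespace IntervalSobolev

variable {a b : ℝ}

theorem memLp_of_continuousOn {w : ℝ → ℂ} (hw : ContinuousOn w (Icc a b)) :
    MemLp w 2 (volume.restrict (Ioo a b)) := by
  obtain ⟨C, hC⟩ := isCompact_Icc.exists_bound_of_continuousOn hw
  refine MemLp.of_bound ((hw.mono Ioo_subset_Icc_self).aestronglyMeasurable measurableSet_Ioo) C ?_
  exact (ae_restrict_iff' measurableSet_Ioo).2
    (Eventually.of_forall fun x hx => hC x (Ioo_subset_Icc_self hx))

theorem integrableOn_Icc (g : L2 a b) : IntegrableOn (fun x => g x) (Icc a b) :=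
  (integrableOn_Icc_iff_integrableOn_Ioo (by finiteness) (by finiteness)).2 (integrable_coe g)

theorem intervalIntegrable (g : L2 a b) {x y : ℝ} (hx : x ∈ Icc a b) (hy : y ∈ Icc a b) :
    IntervalIntegrable (fun x => g x) volume x y := by
  rw [intervalIntegrable_iff]
  refine (integrableOn_Icc g).mono_set (uIoc_subset_uIcc.trans ?_)
  exact uIcc_subset_Icc hx hy

theorem continuousOn_primitive (hab : a < b) (g : L2 a b) :
    ContinuousOn (fun x => ∫ t in a..x, g t) (Icc a b) :=
  intervalIntegral.continuousOn_primitive_interval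
    (by rw [uIcc_of_le hab.le]; exact integrableOn_Icc g) |>.mono (by rw [uIcc_of_le hab.le])

theorem integral_deriv_test (hab : a < b) {φ : ℝ → ℂ} (hφ : IsTest a b φ) :
    ∫ x in Ioo a b, deriv φ x = 0 := by
  rw [← integral_Ioc_eq_integral_Ioo, ← intervalIntegral.integral_of_le hab.le,
    intervalIntegral.integral_deriv_eq_sub (fun x _ => (hφ.contDiff.differentiable
      (by simp)).differentiableAt) (hφ.deriv.contDiff.continuous.intervalIntegrable _ _),
    hφ.eq_zero (x := b) (by simp), hφ.eq_zero (x := a) (by simp), sub_self]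

/-- A function which is, up to a null set, a primitive of `g ∈ L²` has weak derivative `g`. -/
theorem hasWeakDeriv_of_ae_eq_primitive (hab : a < b) {u g : L2 a b} {c : ℂ}
    (hu : u =ᵐ[volume.restrict (Ioo a b)] fun x => (∫ t in a..x, g t) + c) :
    HasWeakDeriv u g := by
  intro φ hφ
  have hG := memLp_of_continuousOn (continuousOn_primitive hab g)
  have hφi : Integrable (deriv φ) (volume.restrict (Ioo a b)) :=
    hφ.deriv.memLp.integrable (by norm_num)
  have e : ∫ x in Ioo a b, u x * deriv φ x
      = ∫ x in Ioo a b, ((∫ t in a..x, g t) * deriv φ x + c * deriv φ x) := by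
    refine integral_congr_ae ?_
    filter_upwards [hu] with x hx
    rw [hx, add_mul]
  have hGφ : Integrable (fun x => (∫ t in a..x, g t) * deriv φ x) (volume.restrict (Ioo a b)) :=
    hG.integrable_mul hφ.deriv.memLp
  rw [e, integral_add hGφ (hφi.const_mul c), integral_const_mul,
    integral_deriv_test hab hφ, integral_primitive_mul_deriv (integrable_coe g) hφ, mul_zero,
    add_zero]

/-- The difference of u and the primitive of u' has zero weak derivative, so it is constant;
evaluation at a identifies the constant. -/
theorem ae_eq_primitive (hab : a < b) (u : W12 a b) :
    (u : L2 a b) =ᵐ[volume.restrict (Ioo a b)]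
      fun x => (∫ t in a..x, weakDeriv a b u t) + eval hab a (left_mem_Icc.2 hab.le) u := by
  set g := weakDeriv a b u with hg
  have hc := continuousOn_primitive hab g
  have hG := memLp_of_continuousOn hc
  have hGi : Integrable (fun x => ∫ t in a..x, g t) (volume.restrict (Ioo a b)) :=
    hG.integrable (by norm_num)
  obtain ⟨c, hc'⟩ := ae_eq_const_of_test hab ((integrable_coe (u : L2 a b)).sub hGi)
    (fun φ hφ => by
      have e : ∫ x in Ioo a b,
          ((fun x => (u : L2 a b) x) - fun x => ∫ t in a..x, g t) x * deriv φ x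
          = ∫ x in Ioo a b, ((u : L2 a b) x * deriv φ x - (∫ t in a..x, g t) * deriv φ x) :=
        integral_congr_ae (Eventually.of_forall fun x => by simp [sub_mul])
      have hGφ : Integrable (fun x => (∫ t in a..x, g t) * deriv φ x)
          (volume.restrict (Ioo a b)) := hG.integrable_mul hφ.deriv.memLp
      rw [e, integral_sub (integrable_mul_test _ hφ.deriv) hGφ, hasWeakDeriv_weakDeriv u φ hφ,
        integral_primitive_mul_deriv (integrable_coe g) hφ, sub_self])
  have hu : (u : L2 a b) =ᵐ[volume.restrict (Ioo a b)] fun x => (∫ t in a..x, g t) + c := by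
    filter_upwards [hc'] with x hx
    rw [← hx]; simp
  rw [eval_eq hab (left_mem_Icc.2 hab.le) u (hc.add continuousOn_const) hu]
  simpa using hu

theorem eval_eq_primitive (hab : a < b) (u : W12 a b) {x : ℝ} (hx : x ∈ Icc a b) :
    eval hab x hx u
      = (∫ t in a..x, weakDeriv a b u t) + eval hab a (left_mem_Icc.2 hab.le) u :=
  eval_eq hab hx u ((continuousOn_primitive hab _).add continuousOn_const) (ae_eq_primitive hab u)

/-- `u` agrees almost everywhere with its point values. -/
theorem ae_eq_eval (hab : a < b) (u : W12 a b) :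
    ∀ᵐ x ∂(volume.restrict (Ioo a b)), ∀ hx : x ∈ Icc a b, (u : L2 a b) x = eval hab x hx u := by
  filter_upwards [ae_eq_primitive hab u] with x hx hxI
  rw [hx, eval_eq_primitive hab u hxI]

/-- The Cauchy-Schwarz inequality for integrals over subintervals. -/
theorem norm_setIntegral_le (g : L2 a b) {x y : ℝ} (hx : a ≤ x) (hxy : x ≤ y) (hy : y ≤ b) :
    ‖∫ t in Ioo x y, g t‖ ≤ √(y - x) * ‖g‖ := by
  have hsub : Ioo x y ⊆ Ioo a b := Ioo_subset_Ioo hx hy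
  have hμ : (volume.restrict (Ioo a b)) (Ioo x y) = ENNReal.ofReal (y - x) := by
    rw [Measure.restrict_apply measurableSet_Ioo, inter_eq_left.2 hsub, Real.volume_Ioo]
  have h1 := L2.inner_indicatorConstLp_one (𝕜 := ℂ) (measurableSet_Ioo (a := x) (b := y))
    (by rw [hμ]; finiteness) g
  rw [Measure.restrict_restrict measurableSet_Ioo, inter_eq_left.2 hsub] at h1
  rw [← h1]
  refine (norm_inner_le_norm _ _).trans ?_
  rw [norm_indicatorConstLp (by norm_num) (by norm_num), measureReal_def, hμ,
    ENNReal.toReal_ofReal (by linarith), norm_one, one_mul, Real.sqrt_eq_rpow]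
  simp

/-- Hölder continuity of exponent 1/2: Cauchy-Schwarz applied to the integral of u' between x and y.
-/
theorem norm_eval_sub_le (hab : a < b) (u : W12 a b) {x y : ℝ} (hx : x ∈ Icc a b)
    (hy : y ∈ Icc a b) :
    ‖eval hab y hy u - eval hab x hx u‖ ≤ √|y - x| * ‖weakDeriv a b u‖ := by
  wlog hxy : x ≤ y generalizing x y
  · rw [norm_sub_rev, abs_sub_comm]
    exact this hy hx (le_of_not_ge hxy)
  have ha := left_mem_Icc.2 hab.le
  have e : eval hab y hy u - eval hab x hx u = ∫ t in Ioo x y, weakDeriv a b u t := by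
    rw [eval_eq_primitive hab u hy, eval_eq_primitive hab u hx, add_sub_add_right_eq_sub,
      intervalIntegral.integral_interval_sub_left (intervalIntegrable _ ha hy)
        (intervalIntegrable _ ha hx), intervalIntegral.integral_of_le hxy,
      integral_Ioc_eq_integral_Ioo]
  rw [e, abs_of_nonneg (by linarith)]
  exact norm_setIntegral_le _ hx.1 hxy hy.2

theorem norm_le_of_eval_le (hab : a < b) (u : W12 a b) {C : ℝ} (hC : 0 ≤ C)
    (h : ∀ x (hx : x ∈ Icc a b), ‖eval hab x hx u‖ ≤ C) :
    ‖(u : L2 a b)‖ ≤ √(b - a) * C := by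
  have h1 : ∀ᵐ x ∂(volume.restrict (Ioo a b)), ‖(u : L2 a b) x‖ ≤ C := by
    filter_upwards [ae_eq_eval hab u, ae_restrict_mem measurableSet_Ioo] with x hx hxI
    rw [hx (Ioo_subset_Icc_self hxI)]
    exact h x _
  refine (Lp.norm_le_of_ae_bound hC h1).trans (le_of_eq ?_)
  congr 1
  rw [measureUnivNNReal, Real.sqrt_eq_rpow]
  simp [ENNReal.coe_toNNReal_eq_toReal, hab.le]

/-- The interpolation inequality for point values. -/
theorem norm_eval_le (hab : a < b) (u : W12 a b) {x : ℝ} (hx : x ∈ Icc a b) {ε : ℝ} (hε : 0 < ε)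
    (hεab : ε ≤ b - a) :
    ‖eval hab x hx u‖ ≤ √ε * ‖weakDeriv a b u‖ + ‖(u : L2 a b)‖ / √ε := by
  -- The value u(x) is compared with the mean of u over an interval of length ε containing x; the
  -- oscillation costs √ε‖u'‖, the mean ‖u‖/√ε.
  obtain ⟨l, r, hl, hr, hlx, hxr, hlr⟩ : ∃ l r, a ≤ l ∧ r ≤ b ∧ l ≤ x ∧ x ≤ r ∧ r - l = ε := by
    rcases le_or_gt (x + ε) b with h | h
    · exact ⟨x, x + ε, hx.1, h, le_rfl, by linarith, by ring⟩
    · exact ⟨b - ε, b, by linarith, le_rfl, by linarith, hx.2, by ring⟩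
  set E := eval hab x hx u with hE
  have hsub : Ioo l r ⊆ Ioo a b := Ioo_subset_Ioo hl hr
  have hvol : volume (Ioo l r) < ⊤ := by rw [Real.volume_Ioo]; finiteness
  have hui : IntegrableOn (fun t => (u : L2 a b) t) (Ioo l r) :=
    (integrable_coe (u : L2 a b)).mono_measure (Measure.restrict_mono hsub le_rfl)
  have h1 : ‖∫ t in Ioo l r, (E - (u : L2 a b) t)‖ ≤ √ε * ‖weakDeriv a b u‖ * ε := by
    have h2 : ∀ᵐ t ∂(volume.restrict (Ioo l r)),
        ‖E - (u : L2 a b) t‖ ≤ √ε * ‖weakDeriv a b u‖ := by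
      filter_upwards [ae_restrict_of_ae_restrict_of_subset hsub (ae_eq_eval hab u),
        ae_restrict_mem measurableSet_Ioo] with t ht htI
      rw [ht (Ioo_subset_Icc_self (hsub htI))]
      refine (norm_eval_sub_le hab u _ _).trans ?_
      gcongr
      rw [abs_le]
      constructor <;> linarith [htI.1, htI.2]
    have h3 := norm_setIntegral_le_of_norm_le_const_ae hvol h2
    rwa [measureReal_def, Real.volume_Ioo, ENNReal.toReal_ofReal (by linarith), hlr] at h3
  have h4 := norm_setIntegral_le (u : L2 a b) hl (by linarith : l ≤ r) hr
  rw [hlr] at h4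
  have h5 : ∫ t in Ioo l r, (E - (u : L2 a b) t) = ε * E - ∫ t in Ioo l r, (u : L2 a b) t := by
    rw [integral_sub (integrable_const E) hui, setIntegral_const, measureReal_def,
      Real.volume_Ioo, ENNReal.toReal_ofReal (by linarith), hlr, Complex.real_smul]
  have h6 : ε * ‖E‖ ≤ √ε * ‖weakDeriv a b u‖ * ε + √ε * ‖(u : L2 a b)‖ := by
    have h7 : (ε : ℂ) * E = (∫ t in Ioo l r, (E - (u : L2 a b) t))
        + ∫ t in Ioo l r, (u : L2 a b) t := by rw [h5]; ring
    calc ε * ‖E‖ = ‖(ε : ℂ) * E‖ := by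
          rw [norm_mul, Complex.norm_real, Real.norm_of_nonneg hε.le]
      _ ≤ _ := by rw [h7]; exact (norm_add_le _ _).trans (add_le_add h1 h4)
  have hs : 0 < √ε := Real.sqrt_pos.2 hε
  refine le_of_mul_le_mul_left ?_ hε
  refine h6.trans (le_of_eq ?_)
  field_simp
  rw [Real.sq_sqrt hε.le]
  ring

theorem norm_eval_sq_le (hab : a < b) (u : W12 a b) {x : ℝ} (hx : x ∈ Icc a b) {ε : ℝ}
    (hε : 0 < ε) (hεab : ε ≤ b - a) :
    ‖eval hab x hx u‖ ^ 2 ≤ 2 * ε * ‖weakDeriv a b u‖ ^ 2 + 2 / ε * ‖(u : L2 a b)‖ ^ 2 := by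
  have h1 := norm_eval_le hab u hx hε hεab
  have h2 : ‖eval hab x hx u‖ ^ 2 ≤ (√ε * ‖weakDeriv a b u‖ + ‖(u : L2 a b)‖ / √ε) ^ 2 := by
    gcongr
  refine h2.trans ((add_sq_le (a := √ε * ‖weakDeriv a b u‖)).trans (le_of_eq ?_))
  rw [mul_pow, div_pow, Real.sq_sqrt hε.le]
  ring

/-- Functions vanishing on a fine grid are small. -/
theorem norm_le_of_eval_grid_eq_zero (hab : a < b) (u : W12 a b) {n : ℕ} (hn : 0 < n)
    (h : ∀ x (hx : x ∈ Icc a b), (∃ k : Fin (n + 1), x = a + k * ((b - a) / n)) →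
      eval hab x hx u = 0) :
    ‖(u : L2 a b)‖ ≤ √(b - a) * (√((b - a) / n) * ‖weakDeriv a b u‖) := by
  have hn' : (0 : ℝ) < n := by exact_mod_cast hn
  have hd : 0 < (b - a) / n := div_pos (by linarith) hn'
  refine norm_le_of_eval_le hab u (by positivity) fun x hx => ?_
  set d := (b - a) / n with hd'
  have hnd : n * d = b - a := by rw [hd']; field_simp
  -- The index of the last grid point not exceeding x, at distance less than d.
  set k := ⌊(x - a) / d⌋₊ with hk
  have hxa : 0 ≤ (x - a) / d := div_nonneg (by linarith [hx.1]) hd.le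
  have hk1 : k * d ≤ x - a := by
    have := Nat.floor_le hxa
    rwa [le_div_iff₀ hd] at this
  have hk2 : x - a < (k + 1) * d := by
    have := Nat.lt_floor_add_one ((x - a) / d)
    rwa [div_lt_iff₀ hd] at this
  have hkn : k < n + 1 := by
    by_contra hlt
    have : ((n : ℝ) + 1) ≤ k := by exact_mod_cast not_lt.1 hlt
    nlinarith [hx.2]
  have hy : a + k * d ∈ Icc a b := ⟨by nlinarith [Nat.cast_nonneg (α := ℝ) k], by linarith [hx.2]⟩
  have h0 := h _ hy ⟨⟨k, hkn⟩, rfl⟩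
  have h1 := norm_eval_sub_le hab u hy hx
  rw [h0, sub_zero] at h1
  refine h1.trans ?_
  gcongr
  rw [abs_le]
  constructor <;> linarith

/-- The element of `W^{1,2}(a, b)` with derivative `g` and value `c` at `a`. -/
theorem exists_primitive (hab : a < b) (g : L2 a b) (c : ℂ) :
    ∃ u : W12 a b, weakDeriv a b u = g ∧ ∀ x (hx : x ∈ Icc a b),
      eval hab x hx u = (∫ t in a..x, g t) + c := by
  have hcont : ContinuousOn (fun x => (∫ t in a..x, g t) + c) (Icc a b) :=
    (continuousOn_primitive hab g).add continuousOn_const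
  have hL := memLp_of_continuousOn hcont
  have hae := hL.coeFn_toLp
  have hw : HasWeakDeriv (hL.toLp _) g := hasWeakDeriv_of_ae_eq_primitive hab hae
  refine ⟨⟨hL.toLp _, g, hw⟩, (hasWeakDeriv_weakDeriv _).unique hw, fun x hx => ?_⟩
  exact eval_eq hab hx _ hcont hae

/-! ### Characterisation of W₀^{1,2} by boundary values; infinite dimension of L² -/

theorem eval_test (hab : a < b) (u : W12 a b) {φ : ℝ → ℂ} (hφ : IsTest a b φ)
    (hu : (u : L2 a b) =ᵐ[volume.restrict (Ioo a b)] φ) {x : ℝ} (hx : x ∈ Icc a b) :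
    eval hab x hx u = φ x :=
  eval_eq hab hx u hφ.contDiff.continuous.continuousOn hu

/-- Elements of `W^{1,2}_0(a, b)` vanish at the end points. -/
theorem eval_eq_zero_of_mem_W120 (hab : a < b) (u : W12 a b) (hu : (u : L2 a b) ∈ W120 a b)
    {x : ℝ} (hx : x ∈ Icc a b) (hx' : x ∉ Ioo a b) : eval hab x hx u = 0 := by
  obtain ⟨u', hu', he⟩ := hu
  obtain rfl : u' = u := Subtype.ext he
  have hL : 0 < b - a := sub_pos.2 hab
  set C := √(b - a) + 1 / √(b - a) with hC
  have hCpos : 0 < C := by positivity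
  have key : ∀ ε : ℝ, 0 < ε → ‖eval hab x hx u'‖ ≤ ε := by
    intro ε hε
    obtain ⟨p, ⟨v, ⟨φ, hφ, hv⟩, rfl⟩, hp⟩ := Metric.mem_closure_iff.1 hu' (ε / C) (by positivity)
    rw [dist_eq_norm, ← map_sub] at hp
    have h1 : ‖((u' - v : W12 a b) : L2 a b)‖ ≤ ε / C :=
      (norm_fst_le (jet a b (u' - v))).trans hp.le
    have h2 : ‖weakDeriv a b (u' - v)‖ ≤ ε / C := (norm_snd_le (jet a b (u' - v))).trans hp.le
    have h3 := norm_eval_le hab (u' - v) hx hL le_rfl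
    rw [map_sub, eval_test hab v hφ hv hx, hφ.eq_zero hx', sub_zero] at h3
    calc _ ≤ _ := h3
      _ ≤ √(b - a) * (ε / C) + (ε / C) / √(b - a) := by gcongr
      _ = ε / C * C := by rw [hC]; ring
      _ = ε := by field_simp
  exact norm_le_zero_iff.1 (le_of_forall_pos_le_add fun ε hε => by simpa using key ε hε)

/-- `W^{1,2}` functions vanishing at the end points belong to `W^{1,2}_0`. -/
theorem mem_W120_of_eval_eq_zero (hab : a < b) (u : W12 a b)
    (ha : eval hab a (left_mem_Icc.2 hab.le) u = 0)
    (hb : eval hab b (right_mem_Icc.2 hab.le) u = 0) : (u : L2 a b) ∈ W120 a b := by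
  refine ⟨u, ?_, rfl⟩
  set g := weakDeriv a b u with hg
  have hg0 : ∫ x in Ioo a b, g x = 0 := by
    have := eval_eq_primitive hab u (right_mem_Icc.2 hab.le)
    rw [ha, hb, add_zero, intervalIntegral.integral_of_le hab.le,
      integral_Ioc_eq_integral_Ioo] at this
    exact this.symm
  obtain ⟨ψ, hψ, hψ1⟩ := exists_test_integral_one hab
  set Ψ : L2 a b := hψ.memLp.toLp _ with hΨ
  have hL : 0 < b - a := sub_pos.2 hab
  set M := 1 + √(b - a) * ‖Ψ‖ with hM
  have hMpos : 0 < M := by positivity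
  set C := 1 + (b - a) with hC
  have hCpos : 0 < C := by positivity
  refine Metric.mem_closure_iff.2 fun ε hε => ?_
  -- Approximate u' in L² by a test function, then subtract a multiple of ψ to make its integral
  -- zero, so that its primitive is again a test function. The constants M and C absorb this
  -- correction and the passage from u' to u.
  obtain ⟨θ, ⟨φ, hφ, hθ⟩, hdist⟩ := Metric.mem_closure_iff.1
    (dense_testSpace.closure_eq ▸ mem_univ g : g ∈ closure (testSpace a b : Set (L2 a b)))
    (ε / 2 / (C * M)) (by positivity)
  rw [dist_eq_norm] at hdist
  set I := ∫ x in Ioo a b, φ x with hI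
  have hint : ∀ {φ : ℝ → ℂ}, IsTest a b φ →
      Integrable φ (volume.restrict (Ioo a b)) := fun hφ => hφ.memLp.integrable (by norm_num)
  have hχ : IsTest a b (φ + (-I) • ψ) := hφ.add (hψ.smul _)
  have hχ0 : ∫ x in Ioo a b, (φ + (-I) • ψ) x = 0 := by
    simp only [Pi.add_apply, Pi.smul_apply, smul_eq_mul]
    rw [integral_add (hint hφ) ((hint hψ).const_mul _), integral_const_mul, hψ1]
    simp [hI]
  obtain ⟨hΦ, hΦ'⟩ := hχ.primitive hab hχ0
  set X : L2 a b := θ + (-I) • Ψ with hX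
  have hXae : X =ᵐ[volume.restrict (Ioo a b)] φ + (-I) • ψ :=
    (Lp.coeFn_add _ _).trans (hθ.add ((Lp.coeFn_smul _ _).trans
      (hψ.memLp.coeFn_toLp.const_smul _)))
  obtain ⟨v, hv', hv⟩ := exists_primitive hab X 0
  have hvI : ∀ x ∈ Icc a b, ∫ t in a..x, X t = ∫ t in a..x, (φ + (-I) • ψ) t := by
    intro x hx
    rw [intervalIntegral.integral_of_le hx.1, intervalIntegral.integral_of_le hx.1,
      integral_Ioc_eq_integral_Ioo, integral_Ioc_eq_integral_Ioo]
    exact integral_congr_ae (ae_restrict_of_ae_restrict_of_subset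
      (Ioo_subset_Ioo le_rfl hx.2) hXae)
  have hvtest : (v : L2 a b) ∈ testSpace a b := by
    refine ⟨_, hΦ, ?_⟩
    filter_upwards [ae_eq_eval hab v, ae_restrict_mem measurableSet_Ioo] with x hx hxI
    have hxI' := Ioo_subset_Icc_self hxI
    rw [hx hxI', hv x hxI', add_zero, hvI x hxI']
  refine ⟨jet a b v, ⟨v, hvtest, rfl⟩, ?_⟩
  -- The correction is small because u' itself has integral zero, both boundary values of u being
  -- zero.
  have hIb : ‖I‖ ≤ √(b - a) * ‖g - θ‖ := by
    have h1 := norm_setIntegral_le (g - θ) le_rfl hab.le le_rfl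
    have h2 : ∫ t in Ioo a b, (g - θ) t = -I := by
      rw [integral_congr_ae (Lp.coeFn_sub g θ)]
      simp only [Pi.sub_apply]
      rw [integral_sub (integrable_coe g) (integrable_coe θ), hg0, integral_congr_ae hθ, zero_sub]
    rwa [h2, norm_neg] at h1
  have hgX : ‖g - X‖ ≤ ε / 2 / C := by
    have e : g - X = (g - θ) + I • Ψ := by rw [hX]; module
    calc ‖g - X‖ ≤ ‖g - θ‖ + ‖I‖ * ‖Ψ‖ := by
          rw [e]; exact (norm_add_le _ _).trans (by rw [norm_smul])
      _ ≤ ‖g - θ‖ + √(b - a) * ‖g - θ‖ * ‖Ψ‖ := by gcongr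
      _ = ‖g - θ‖ * M := by rw [hM]; ring
      _ ≤ ε / 2 / (C * M) * M := by gcongr
      _ = ε / 2 / C := by field_simp
  have hw' : weakDeriv a b (u - v) = g - X := by rw [map_sub, hv']
  have hu0 : ∀ x (hx : x ∈ Icc a b), ‖eval hab x hx (u - v)‖ ≤ √(b - a) * ‖g - X‖ := by
    intro x hx
    have h1 := norm_eval_sub_le hab (u - v) (left_mem_Icc.2 hab.le) hx
    have h2 : eval hab a (left_mem_Icc.2 hab.le) (u - v) = 0 := by
      rw [map_sub, ha, hv]; simp
    rw [h2, sub_zero, hw'] at h1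
    refine h1.trans ?_
    gcongr
    rw [abs_le]
    constructor <;> linarith [hx.1, hx.2]
  have huv := norm_le_of_eval_le hab (u - v) (by positivity) hu0
  rw [← mul_assoc, Real.mul_self_sqrt hL.le] at huv
  rw [dist_eq_norm, ← map_sub]
  refine lt_of_le_of_lt (norm_prod_le_iff.2 ⟨?_, ?_⟩) (half_lt_self hε)
  · change ‖((u - v : W12 a b) : L2 a b)‖ ≤ ε / 2
    calc _ ≤ (b - a) * ‖g - X‖ := huv
      _ ≤ C * (ε / 2 / C) := by gcongr; linarith
      _ = ε / 2 := by field_simp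
  · change ‖weakDeriv a b (u - v)‖ ≤ ε / 2
    rw [hw']
    refine hgX.trans (div_le_self (by positivity) (by linarith))

/-- Polynomials embed into L²: one that vanishes almost everywhere on the interval has infinitely
many roots. -/
theorem not_finiteDimensional_L2 (hab : a < b) : ¬ FiniteDimensional ℂ (L2 a b) := by
  intro hfd
  have hcont : ∀ p : Polynomial ℂ, Continuous fun x : ℝ => p.eval (x : ℂ) := fun p =>
    p.continuous.comp Complex.continuous_ofReal
  have hL : ∀ p : Polynomial ℂ, MemLp (fun x : ℝ => p.eval (x : ℂ)) 2
      (volume.restrict (Ioo a b)) := fun p => memLp_of_continuousOn (hcont p).continuousOn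
  let F : Polynomial ℂ →ₗ[ℂ] L2 a b :=
    { toFun := fun p => (hL p).toLp _
      map_add' := fun p q => by
        rw [← MemLp.toLp_add]
        exact MemLp.toLp_congr _ _ (Eventually.of_forall fun x => by simp)
      map_smul' := fun c p => by
        rw [RingHom.id_apply, ← MemLp.toLp_const_smul]
        exact MemLp.toLp_congr _ _ (Eventually.of_forall fun x => by simp) }
  have hF : Function.Injective F := by
    rw [injective_iff_map_eq_zero]
    intro p hp
    have h1 : (fun x : ℝ => p.eval (x : ℂ)) =ᵐ[volume.restrict (Ioo a b)] fun _ => 0 :=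
      ((hL p).coeFn_toLp.symm.trans (by rw [show (hL p).toLp _ = 0 from hp])).trans
        (Lp.coeFn_zero _ _ _)
    have h2 := eqOn_of_ae_eq hab (hcont p).continuousOn continuousOn_const h1
    refine p.eq_zero_of_infinite_isRoot ?_
    refine ((Icc_infinite hab).image Complex.ofReal_injective.injOn).mono ?_
    rintro _ ⟨x, hx, rfl⟩
    exact h2 hx
  exact Polynomial.not_finite (Module.Finite.of_injective F hF)

end IntervalSobolev

/-! ### Sobolev functions as a Hilbert space of pairs (u, u') -/

namespace IntervalSobolev

variable {a b : ℝ}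

theorem continuous_integral_mul_test {φ : ℝ → ℂ} (hφ : IsTest a b φ) :
    Continuous fun u : L2 a b => ∫ x in Ioo a b, u x * φ x := by
  have hφ' : MemLp (fun x => (starRingEnd ℂ) (φ x)) 2 (volume.restrict (Ioo a b)) :=
    memLp_of_continuousOn (Complex.continuous_conj.comp hφ.contDiff.continuous).continuousOn
  have e : (fun u : L2 a b => ∫ x in Ioo a b, u x * φ x) = fun u => inner ℂ (hφ'.toLp _) u := by
    funext u
    rw [L2.inner_def]
    refine integral_congr_ae ?_
    filter_upwards [hφ'.coeFn_toLp] with x hx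
    rw [hx]
    simp [RCLike.inner_apply]
  rw [e]
  fun_prop

/-- For each test function the defining identity is a closed condition, since both sides depend
continuously on the pair in L². This gives completeness of W^{1,2}. -/
theorem isClosed_hasWeakDeriv :
    IsClosed {p : WithLp 2 (L2 a b × L2 a b) | HasWeakDeriv p.fst p.snd} := by
  have hf : Continuous fun p : WithLp 2 (L2 a b × L2 a b) => p.fst :=
    continuous_fst.comp (WithLp.prod_continuous_ofLp 2 _ _)
  have hs : Continuous fun p : WithLp 2 (L2 a b × L2 a b) => p.snd :=
    continuous_snd.comp (WithLp.prod_continuous_ofLp 2 _ _)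
  simp only [HasWeakDeriv, ofPred_forall]
  refine isClosed_iInter fun φ => isClosed_iInter fun hφ => ?_
  exact isClosed_eq ((continuous_integral_mul_test hφ.deriv).comp hf)
    ((continuous_integral_mul_test hφ).comp hs).neg

/-- The pairs `(u, u')` with `u ∈ D`, as a subspace of the Hilbert space `L² ⊕ L²`. -/
def sobolevGraph (D : Submodule ℂ (L2 a b)) : Submodule ℂ (WithLp 2 (L2 a b × L2 a b)) where
  carrier := {p | p.fst ∈ D ∧ HasWeakDeriv p.fst p.snd}
  zero_mem' := ⟨D.zero_mem, HasWeakDeriv.zero⟩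
  add_mem' hp hq := ⟨D.add_mem hp.1 hq.1, hp.2.add hq.2⟩
  smul_mem' c _ hp := ⟨D.smul_mem c hp.1, hp.2.smul c⟩

theorem isClosed_sobolevGraph_W12 :
    IsClosed (sobolevGraph (W12 a b) : Set (WithLp 2 (L2 a b × L2 a b))) := by
  convert isClosed_hasWeakDeriv (a := a) (b := b) using 1
  ext p
  exact ⟨fun hp => hp.2, fun hp => ⟨⟨_, hp⟩, hp⟩⟩

theorem isClosed_sobolevGraph_W120 :
    IsClosed (sobolevGraph (W120 a b) : Set (WithLp 2 (L2 a b × L2 a b))) := by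
  have h1 : IsClosed {p : WithLp 2 (L2 a b × L2 a b) | WithLp.ofLp p ∈
      (Submodule.map (jet a b) <| Submodule.comap (W12 a b).subtype
        (testSpace a b)).topologicalClosure} :=
    (Submodule.isClosed_topologicalClosure _).preimage (WithLp.prod_continuous_ofLp 2 _ _)
  convert (isClosed_hasWeakDeriv (a := a) (b := b)).inter h1 using 1
  ext p
  have hjet : ∀ (w : W12 a b) (_ : (w : L2 a b) = p.fst), HasWeakDeriv p.fst p.snd →
      jet a b w = WithLp.ofLp p := fun w hw hp =>
    Prod.ext hw ((hasWeakDeriv_weakDeriv w).unique (hw ▸ hp))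
  constructor
  · rintro ⟨⟨w, hw, hwp⟩, hp⟩
    refine ⟨hp, ?_⟩
    rw [mem_ofPred_eq, ← hjet w hwp hp]
    exact hw
  · rintro ⟨hp, hp'⟩
    refine ⟨⟨⟨p.fst, _, hp⟩, ?_, rfl⟩, hp⟩
    rw [SetLike.mem_coe, Submodule.mem_comap, hjet ⟨p.fst, _, hp⟩ rfl hp]
    exact hp'

variable {D : Submodule ℂ (L2 a b)}

/-- The Sobolev function with a given graph point. -/
def graphFun (D : Submodule ℂ (L2 a b)) : sobolevGraph D →ₗ[ℂ] W12 a b where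
  toFun p := ⟨(p : WithLp 2 (L2 a b × L2 a b)).fst, _, p.2.2⟩
  map_add' _ _ := rfl
  map_smul' _ _ := rfl

theorem weakDeriv_graphFun (p : sobolevGraph D) :
    weakDeriv a b (graphFun D p) = (p : WithLp 2 (L2 a b × L2 a b)).snd :=
  (hasWeakDeriv_weakDeriv _).unique p.2.2

theorem norm_sq_graph (p : sobolevGraph D) :
    ‖p‖ ^ 2 = ‖(graphFun D p : L2 a b)‖ ^ 2 + ‖weakDeriv a b (graphFun D p)‖ ^ 2 := by
  rw [weakDeriv_graphFun]
  exact WithLp.prod_norm_sq_eq_of_L2 (p : WithLp 2 (L2 a b × L2 a b))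

theorem norm_graphFun_le (p : sobolevGraph D) : ‖(graphFun D p : L2 a b)‖ ≤ ‖p‖ := by
  have := norm_sq_graph p
  refine abs_le_of_sq_le_sq' ?_ (norm_nonneg _) |>.2
  nlinarith [sq_nonneg ‖weakDeriv a b (graphFun D p)‖]

theorem norm_weakDeriv_graphFun_le (p : sobolevGraph D) :
    ‖weakDeriv a b (graphFun D p)‖ ≤ ‖p‖ := by
  have := norm_sq_graph p
  refine abs_le_of_sq_le_sq' ?_ (norm_nonneg _) |>.2
  nlinarith [sq_nonneg ‖(graphFun D p : L2 a b)‖]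

/-- The embedding `(u, u') ↦ u`. -/
noncomputable def graphEmb (D : Submodule ℂ (L2 a b)) : sobolevGraph D →L[ℂ] L2 a b :=
  LinearMap.mkContinuous ((W12 a b).subtype.comp (graphFun D)) 1
    fun p => by rw [one_mul]; exact norm_graphFun_le p

/-- The derivative `(u, u') ↦ u'`. -/
noncomputable def graphDeriv (D : Submodule ℂ (L2 a b)) : sobolevGraph D →L[ℂ] L2 a b :=
  LinearMap.mkContinuous ((weakDeriv a b).comp (graphFun D)) 1
    fun p => by rw [one_mul]; exact norm_weakDeriv_graphFun_le p

/-- Point evaluation as a continuous functional. -/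
noncomputable def graphEval (D : Submodule ℂ (L2 a b)) (hab : a < b) (x : ℝ) (hx : x ∈ Icc a b) :
    sobolevGraph D →L[ℂ] ℂ :=
  LinearMap.mkContinuous ((eval hab x hx).comp (graphFun D)) (√(b - a) + 1 / √(b - a))
    fun p => by
      have h1 := norm_eval_le hab (graphFun D p) hx (sub_pos.2 hab) le_rfl
      refine h1.trans ?_
      rw [add_mul, div_mul_eq_mul_div, one_mul]
      gcongr
      · exact norm_weakDeriv_graphFun_le p
      · exact norm_graphFun_le p

theorem graphEmb_apply (p : sobolevGraph D) : graphEmb D p = graphFun D p := rfl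

theorem graphDeriv_apply (p : sobolevGraph D) : graphDeriv D p = weakDeriv a b (graphFun D p) :=
  rfl

theorem graphEval_apply (hab : a < b) {x : ℝ} (hx : x ∈ Icc a b) (p : sobolevGraph D) :
    graphEval D hab x hx p = eval hab x hx (graphFun D p) := rfl

/-- The embedding `W^{1,2}(a, b) ⊂ L²(a, b)` is compact. -/
theorem isCompactOperator_graphEmb (hab : a < b)
    (hD : IsClosed (sobolevGraph D : Set (WithLp 2 (L2 a b × L2 a b)))) :
    IsCompactOperator (graphEmb D) := by
  have : CompleteSpace (sobolevGraph D) := hD.completeSpace_coe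
  refine isCompactOperator_of_small_on_ker _ fun ε hε => ?_
  have hL : 0 < b - a := sub_pos.2 hab
  -- Functions vanishing on the grid of n steps satisfy ‖u‖ ≤ (b - a)/√n · ‖u'‖, so this n makes the
  -- factor at most ε. The finitely many functionals are the evaluations at the n + 1 grid points.
  obtain ⟨n, hn⟩ := exists_nat_gt ((b - a) ^ 2 / ε ^ 2)
  have hn0 : (0 : ℝ) < n := lt_of_le_of_lt (by positivity) hn
  have hgrid : ∀ k : Fin (n + 1), a + k * ((b - a) / n) ∈ Icc a b := by
    intro k
    have hk : (k : ℝ) ≤ n := by exact_mod_cast Nat.lt_succ_iff.1 k.2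
    have h1 : (k : ℝ) * ((b - a) / n) ≤ n * ((b - a) / n) := by gcongr
    have h2 : (n : ℝ) * ((b - a) / n) = b - a := by field_simp
    exact ⟨le_add_of_nonneg_right (by positivity), by linarith⟩
  refine ⟨n + 1, ContinuousLinearMap.pi fun k => graphEval D hab _ (hgrid k), fun p hp => ?_⟩
  have h0 : ∀ x (hx : x ∈ Icc a b), (∃ k : Fin (n + 1), x = a + k * ((b - a) / n)) →
      eval hab x hx (graphFun D p) = 0 := by
    rintro x hx ⟨k, rfl⟩
    exact congrFun hp k
  have h1 := norm_le_of_eval_grid_eq_zero hab (graphFun D p) (by exact_mod_cast hn0) h0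
  rw [graphEmb_apply]
  refine h1.trans ?_
  rw [← mul_assoc, ← Real.sqrt_mul hL.le]
  gcongr
  · rw [Real.sqrt_le_left hε.le, ← mul_div_assoc, ← sq, div_le_iff₀ hn0]
    rw [div_lt_iff₀ (by positivity)] at hn
    linarith
  · exact norm_weakDeriv_graphFun_le p

end IntervalSobolev

/-! ### Coercivity and compact resolvents of the Robin and Dirichlet forms -/

namespace DeltaInteraction

open UnboundedOp IntervalSobolev

variable {xm xp : ℝ}

theorem deltaExpr_apply (hx : xm < xp) (α : ℝ) (u v : W12 xm xp) :
    deltaExpr hx α u v = inner ℂ (weakDeriv xm xp v) (weakDeriv xm xp u)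
      + α * (eval hx _ (mid_mem hx) u * starRingEnd ℂ (eval hx _ (mid_mem hx) v)) := rfl

theorem robinExpr_apply (hx : xm < xp) (α βm βp : ℝ) (u v : W12 xm xp) :
    robinExpr hx α βm βp u v = deltaExpr hx α u v
      + 1 / 2 * (βm * (eval hx xm (left_mem hx) u * starRingEnd ℂ (eval hx xm (left_mem hx) v))
        + βp * (eval hx xp (right_mem hx) u * starRingEnd ℂ (eval hx xp (right_mem hx) v))) := rfl

theorem deltaExpr_conj (hx : xm < xp) (α : ℝ) (u v : W12 xm xp) :
    starRingEnd ℂ (deltaExpr hx α u v) = deltaExpr hx α v u := by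
  simp only [deltaExpr_apply, map_add, map_mul, inner_conj_symm, Complex.conj_ofReal,
    Complex.conj_conj]
  ring

theorem robinExpr_self_re (hx : xm < xp) (α βm βp : ℝ) (u : W12 xm xp) :
    (robinExpr hx α βm βp u u).re = (deltaExpr hx α u u).re
      + 1 / 2 * (βm * ‖eval hx xm (left_mem hx) u‖ ^ 2
        + βp * ‖eval hx xp (right_mem hx) u‖ ^ 2) := by
  rw [robinExpr_apply, Complex.mul_conj', Complex.mul_conj', Complex.add_re]
  congr 1
  rw [← Complex.ofReal_re (1 / 2 * _)]
  push_cast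
  rfl

theorem deltaExpr_self_re (hx : xm < xp) (α : ℝ) (u : W12 xm xp) :
    (deltaExpr hx α u u).re = ‖weakDeriv xm xp u‖ ^ 2
      + α * ‖eval hx _ (mid_mem hx) u‖ ^ 2 := by
  rw [deltaExpr_apply, Complex.mul_conj', Complex.add_re, ← inner_self_eq_norm_sq (𝕜 := ℂ),
    ← Complex.ofReal_pow, Complex.re_ofReal_mul, Complex.ofReal_re]
  rfl

theorem robinExpr_zero (hx : xm < xp) (α : ℝ) (u v : W12 xm xp) :
    robinExpr hx α 0 0 u v = deltaExpr hx α u v := by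
  simp [robinExpr_apply]

/-- Each point term is bounded by its coefficient times 2ε‖u'‖² + (2/ε)‖u‖². A small ε leaves half
of ‖u'‖², and c absorbs the multiples of ‖u‖². -/
theorem exists_coercive (hx : xm < xp) (α βm βp : ℝ) :
    ∃ c : ℝ, ∀ u : W12 xm xp,
      1 / 2 * (‖(u : L2 xm xp)‖ ^ 2 + ‖weakDeriv xm xp u‖ ^ 2)
        ≤ (robinExpr hx α βm βp u u).re + c * ‖(u : L2 xm xp)‖ ^ 2 := by
  set M := |α| + |βm| + |βp| + 1 with hM
  have hMpos : 0 < M := by positivity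
  set ε := min (xp - xm) (1 / (4 * M)) with hε
  have hεpos : 0 < ε := lt_min (sub_pos.2 hx) (by positivity)
  have hεM : 4 * M * ε ≤ 1 := by
    have : ε ≤ 1 / (4 * M) := min_le_right _ _
    rwa [le_div_iff₀ (by positivity), mul_comm] at this
  refine ⟨1 / 2 + M * (2 / ε), fun u => ?_⟩
  set n := ‖(u : L2 xm xp)‖ ^ 2 with hn
  set d := ‖weakDeriv xm xp u‖ ^ 2 with hd
  have hdn : 0 ≤ d := by positivity
  set B := 2 * ε * d + 2 / ε * n with hB
  have hbd : ∀ x (hxI : x ∈ Icc xm xp), ‖eval hx x hxI u‖ ^ 2 ≤ B := fun x hxI =>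
    norm_eval_sq_le hx u hxI hεpos (min_le_left _ _)
  have hle : ∀ (γ : ℝ) (x) (hxI : x ∈ Icc xm xp), -(|γ| * B) ≤ γ * ‖eval hx x hxI u‖ ^ 2 := by
    intro γ x hxI
    have h1 : |γ| * ‖eval hx x hxI u‖ ^ 2 ≤ |γ| * B := by gcongr; exact hbd x hxI
    have h2 : -|γ| * ‖eval hx x hxI u‖ ^ 2 ≤ γ * ‖eval hx x hxI u‖ ^ 2 := by
      gcongr; exact neg_abs_le γ
    linarith
  rw [robinExpr_self_re, deltaExpr_self_re]
  have h1 := hle α _ (mid_mem hx)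
  have h2 := hle βm _ (left_mem hx)
  have h3 := hle βp _ (right_mem hx)
  have hB0 : 0 ≤ B := by positivity
  have h4 : M * B ≤ 1 / 2 * d + M * (2 / ε) * n := by
    have : M * B = (4 * M * ε) * d / 2 + M * (2 / ε) * n := by rw [hB]; ring
    rw [this]
    nlinarith
  have h5 : (|α| + 1 / 2 * |βm| + 1 / 2 * |βp|) * B ≤ M * B := by
    gcongr
    rw [hM]
    linarith [abs_nonneg βm, abs_nonneg βp]
  linarith

/-- Restrictions of the Robin form to closed subspaces of `W^{1,2}` have compact resolvent. -/
theorem exists_hasCompactResolvent (hx : xm < xp) (α βm βp : ℝ) (h : DenseForm (L2 xm xp))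
    (hle : h.domain ≤ W12 xm xp)
    (hcl : IsClosed (sobolevGraph h.domain : Set (WithLp 2 (L2 xm xp × L2 xm xp))))
    (hform : ∀ u v, h.form u v
      = robinExpr hx α βm βp (Submodule.inclusion hle u) (Submodule.inclusion hle v)) :
    ∃ c K, h.HasCompactResolvent c K := by
  have : CompleteSpace (sobolevGraph h.domain) := hcl.completeSpace_coe
  set D := h.domain
  obtain ⟨c, hc⟩ := exists_coercive hx α βm βp
  obtain ⟨T, hTs, hT⟩ := exists_isSymmetric_of_form (graphDeriv D)
    ![graphEval D hx _ (mid_mem hx), graphEval D hx _ (left_mem hx), graphEval D hx _ (right_mem hx)]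
    ![α, 1 / 2 * βm, 1 / 2 * βp]
  have hT' : ∀ p q, inner ℂ q (T p) = robinExpr hx α βm βp (graphFun D p) (graphFun D q) := by
    intro p q
    rw [hT, Fin.sum_univ_three, robinExpr_apply, deltaExpr_apply]
    simp only [Matrix.cons_val, graphDeriv_apply, graphEval_apply]
    push_cast
    ring
  refine ⟨c, h.exists_hasCompactResolvent (graphEmb D) (isCompactOperator_graphEmb hx hcl)
    (fun p => p.2.1) (fun w => ?_) T hTs ?_ (ε := 1 / 2) (by norm_num) ?_⟩
  · exact ⟨⟨WithLp.toLp 2 ((w : L2 xm xp), weakDeriv xm xp ⟨w, hle w.2⟩),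
      w.2, hasWeakDeriv_weakDeriv ⟨w, hle w.2⟩⟩, rfl⟩
  · intro p q
    rw [hT', hform]
    rfl
  · intro p
    rw [hT', norm_sq_graph]
    exact hc (graphFun D p)

theorem exists_hasCompactResolvent_robinForm (hx : xm < xp) (α βm βp : ℝ) :
    ∃ c K, (robinForm hx α βm βp).HasCompactResolvent c K :=
  exists_hasCompactResolvent hx α βm βp _ le_rfl isClosed_sobolevGraph_W12 fun _ _ => rfl

/-- The Dirichlet form is the Robin form with zero boundary coefficients, restricted to W₀^{1,2}. -/
theorem exists_hasCompactResolvent_dirichletForm (hx : xm < xp) (α : ℝ) :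
    ∃ c K, (dirichletForm hx α).HasCompactResolvent c K :=
  exists_hasCompactResolvent hx α 0 0 _ W120_le_W12 isClosed_sobolevGraph_W120 fun u v => by
    rw [robinExpr_zero]; rfl

end DeltaInteraction

/-! ### Comparison of Robin and Dirichlet trial spaces -/

namespace DeltaInteraction

open UnboundedOp IntervalSobolev

variable {xm xp : ℝ}

/-- The quadratic form `‖u'‖² + α |u(y)|² + c ‖u‖²` on `W^{1,2}`. -/
noncomputable def deltaQuad (hx : xm < xp) (α c : ℝ) (u : W12 xm xp) : ℝ :=
  (deltaExpr hx α u u).re + c * ‖(u : L2 xm xp)‖ ^ 2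

/-- A weighted parallelogram identity. When the quadratic form is nonnegative and δ > 0, dropping
the second term on the left gives Young's inequality. -/
theorem deltaQuad_young (hx : xm < xp) (α c : ℝ) {δ : ℝ} (hδ : δ ≠ 0) (u v : W12 xm xp) :
    deltaQuad hx α c (u - v) + 1 / δ * deltaQuad hx α c ((δ : ℂ) • u + v)
      = (1 + δ) * deltaQuad hx α c u + (1 + 1 / δ) * deltaQuad hx α c v := by
  have hre : (deltaExpr hx α v u).re = (deltaExpr hx α u v).re := by
    rw [← deltaExpr_conj, Complex.conj_re]
  have h1 : (deltaExpr hx α (u - v) (u - v)).re = (deltaExpr hx α u u).re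
      - 2 * (deltaExpr hx α u v).re + (deltaExpr hx α v v).re := by
    simp only [map_sub, LinearMap.sub_apply, Complex.sub_re, hre]
    ring
  have h2 : (deltaExpr hx α ((δ : ℂ) • u + v) ((δ : ℂ) • u + v)).re
      = δ ^ 2 * (deltaExpr hx α u u).re
      + 2 * δ * (deltaExpr hx α u v).re + (deltaExpr hx α v v).re := by
    simp only [map_add, LinearMap.add_apply, map_smul, LinearMap.smul_apply, map_smulₛₗ,
      Complex.conj_ofReal, smul_eq_mul, Complex.add_re, Complex.re_ofReal_mul, hre]
    ring
  have h3 : ‖((u - v : W12 xm xp) : L2 xm xp)‖ ^ 2 = ‖(u : L2 xm xp)‖ ^ 2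
      - 2 * (inner ℂ (u : L2 xm xp) (v : L2 xm xp)).re + ‖(v : L2 xm xp)‖ ^ 2 := by
    rw [Submodule.coe_sub, @norm_sub_sq ℂ]
    rfl
  have h4 : ‖(((δ : ℂ) • u + v : W12 xm xp) : L2 xm xp)‖ ^ 2 = δ ^ 2 * ‖(u : L2 xm xp)‖ ^ 2
      + 2 * δ * (inner ℂ (u : L2 xm xp) (v : L2 xm xp)).re + ‖(v : L2 xm xp)‖ ^ 2 := by
    rw [Submodule.coe_add, Submodule.coe_smul, @norm_add_sq ℂ, norm_smul, mul_pow,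
      Complex.norm_real, Real.norm_eq_abs, sq_abs, inner_smul_left, Complex.conj_ofReal,
      RCLike.re_to_complex, Complex.re_ofReal_mul]
    ring
  simp only [deltaQuad, h1, h2, h3, h4]
  field_simp
  ring

theorem deltaQuad_smul (hx : xm < xp) (α c : ℝ) (z : ℂ) (u : W12 xm xp) :
    deltaQuad hx α c (z • u) = ‖z‖ ^ 2 * deltaQuad hx α c u := by
  have h1 : deltaExpr hx α (z • u) (z • u) = ((‖z‖ ^ 2 : ℝ) : ℂ) * deltaExpr hx α u u := by
    simp only [map_smul, LinearMap.smul_apply, map_smulₛₗ, smul_eq_mul]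
    rw [← mul_assoc, Complex.conj_mul', Complex.ofReal_pow]
  rw [deltaQuad, deltaQuad, h1, Complex.re_ofReal_mul, Submodule.coe_smul, norm_smul]
  ring

/-- Functions with prescribed boundary values. -/
theorem exists_boundary_functions (hx : xm < xp) :
    ∃ em ep : W12 xm xp,
      eval hx xm (left_mem hx) em = 1 ∧ eval hx xp (right_mem hx) em = 0 ∧
      eval hx xm (left_mem hx) ep = 0 ∧ eval hx xp (right_mem hx) ep = 1 := by
  have hL : MemLp (fun _ : ℝ => (1 : ℂ)) 2 (volume.restrict (Ioo xm xp)) :=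
    memLp_of_continuousOn continuousOn_const
  have hne : ((xp - xm : ℝ) : ℂ) ≠ 0 := by exact_mod_cast (sub_pos.2 hx).ne'
  obtain ⟨e, -, he⟩ := exists_primitive hx (hL.toLp _) 0
  obtain ⟨o, -, ho⟩ := exists_primitive hx (0 : L2 xm xp) 1
  have hem : eval hx xm (left_mem hx) e = 0 := by rw [he]; simp
  have hep : eval hx xp (right_mem hx) e = ((xp - xm : ℝ) : ℂ) := by
    rw [he, intervalIntegral.integral_of_le hx.le, integral_Ioc_eq_integral_Ioo,
      integral_congr_ae hL.coeFn_toLp]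
    simp [hx.le]
  have hoc : ∀ x (hxI : x ∈ Icc xm xp), eval hx x hxI o = 1 := by
    intro x hxI
    rw [ho, intervalIntegral.integral_of_le hxI.1, integral_Ioc_eq_integral_Ioo,
      integral_congr_ae (ae_restrict_of_ae_restrict_of_subset (Ioo_subset_Ioo le_rfl hxI.2)
        (Lp.coeFn_zero ℂ 2 (volume.restrict (Ioo xm xp))))]
    simp
  -- Here o is the constant 1 and e is x - x₋, so these are the affine functions interpolating the
  -- values 0 and 1.
  refine ⟨o - (((xp - xm : ℝ) : ℂ))⁻¹ • e, (((xp - xm : ℝ) : ℂ))⁻¹ • e, ?_, ?_, ?_, ?_⟩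
  · simp [hoc, hem]
  · rw [map_sub, map_smul, hoc, hep, smul_eq_mul, inv_mul_cancel₀ hne, sub_self]
  · simp [hem]
  · rw [map_smul, hep, smul_eq_mul, inv_mul_cancel₀ hne]

/-- Correction of the boundary values: `u` is the sum of an element of `W^{1,2}_0` and a remainder
which is controlled by the boundary values of `u`. -/
theorem exists_boundary_correction (hx : xm < xp) (α c : ℝ)
    (hc : ∀ u : W12 xm xp, 0 ≤ deltaQuad hx α c u) :
    ∃ (R : W12 xm xp →ₗ[ℂ] W12 xm xp) (C : ℝ), 0 ≤ C ∧
      ∀ u, ((u - R u : W12 xm xp) : L2 xm xp) ∈ W120 xm xp ∧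
        deltaQuad hx α c (R u) ≤ C * (‖eval hx xm (left_mem hx) u‖ ^ 2
          + ‖eval hx xp (right_mem hx) u‖ ^ 2) ∧
        ‖(R u : L2 xm xp)‖ ^ 2 ≤ C * (‖eval hx xm (left_mem hx) u‖ ^ 2
          + ‖eval hx xp (right_mem hx) u‖ ^ 2) := by
  obtain ⟨em, ep, h1, h2, h3, h4⟩ := exists_boundary_functions hx
  let R : W12 xm xp →ₗ[ℂ] W12 xm xp :=
    (eval hx xm (left_mem hx)).smulRight em + (eval hx xp (right_mem hx)).smulRight ep
  have hR : ∀ u, R u = eval hx xm (left_mem hx) u • em + eval hx xp (right_mem hx) u • ep :=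
    fun u => rfl
  set q := deltaQuad hx α c with hq
  set C := 2 * (q em + q ep) + 2 * (‖(em : L2 xm xp)‖ ^ 2 + ‖(ep : L2 xm xp)‖ ^ 2) with hC
  have hqm := hc em
  have hqp := hc ep
  have hCq : 2 * (q em + q ep) ≤ C := by rw [hC]; exact le_add_of_nonneg_right (by positivity)
  have hCn : 2 * (‖(em : L2 xm xp)‖ ^ 2 + ‖(ep : L2 xm xp)‖ ^ 2) ≤ C := by
    rw [hC]; exact le_add_of_nonneg_left (by positivity)
  refine ⟨R, C, by positivity, fun u => ⟨?_, ?_, ?_⟩⟩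
  · refine mem_W120_of_eval_eq_zero hx _ ?_ ?_
    · rw [map_sub, hR, map_add, map_smul, map_smul, h1, h3]; simp
    · rw [map_sub, hR, map_add, map_smul, map_smul, h2, h4]; simp
  · set zm := eval hx xm (left_mem hx) u
    set zp := eval hx xp (right_mem hx) u
    have hn : ∀ w, q (-w) = q w := fun w => by
      rw [hq, ← neg_one_smul ℂ w, deltaQuad_smul]; simp
    have hz := deltaQuad_young hx α c one_ne_zero (zm • em) (-(zp • ep))
    rw [← hq, hn, hq, deltaQuad_smul, deltaQuad_smul, ← hq, sub_neg_eq_add, ← hR] at hz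
    have hz' := hc (((1 : ℝ) : ℂ) • (zm • em) + -(zp • ep))
    have hm2 := sq_nonneg ‖zm‖
    have hp2 := sq_nonneg ‖zp‖
    have : q (R u) ≤ 2 * (‖zm‖ ^ 2 * q em) + 2 * (‖zp‖ ^ 2 * q ep) := by linarith
    calc q (R u) ≤ 2 * (‖zm‖ ^ 2 * q em) + 2 * (‖zp‖ ^ 2 * q ep) := this
      _ ≤ 2 * (q em + q ep) * (‖zm‖ ^ 2 + ‖zp‖ ^ 2) := by
        nlinarith [mul_nonneg hm2 hqp, mul_nonneg hp2 hqm]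
      _ ≤ _ := by gcongr
  · set zm := eval hx xm (left_mem hx) u
    set zp := eval hx xp (right_mem hx) u
    have hn : ‖(R u : L2 xm xp)‖ ≤ ‖zm‖ * ‖(em : L2 xm xp)‖ + ‖zp‖ * ‖(ep : L2 xm xp)‖ := by
      rw [hR, Submodule.coe_add, Submodule.coe_smul, Submodule.coe_smul]
      refine (norm_add_le _ _).trans ?_
      rw [norm_smul, norm_smul]
    calc ‖(R u : L2 xm xp)‖ ^ 2
        ≤ (‖zm‖ * ‖(em : L2 xm xp)‖ + ‖zp‖ * ‖(ep : L2 xm xp)‖) ^ 2 := by gcongr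
      _ ≤ 2 * ((‖zm‖ * ‖(em : L2 xm xp)‖) ^ 2 + (‖zp‖ * ‖(ep : L2 xm xp)‖) ^ 2) := add_sq_le
      _ ≤ 2 * (‖(em : L2 xm xp)‖ ^ 2 + ‖(ep : L2 xm xp)‖ ^ 2) * (‖zm‖ ^ 2 + ‖zp‖ ^ 2) := by
        nlinarith [sq_nonneg (‖zm‖ * ‖(ep : L2 xm xp)‖), sq_nonneg (‖zp‖ * ‖(em : L2 xm xp)‖)]
      _ ≤ _ := by gcongr

theorem mem_trialValues_robinForm (hx : xm < xp) (α βm βp : ℝ) (j : ℕ) (t : ℝ) :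
    t ∈ (robinForm hx α βm βp).trialValues j ↔ ∃ f : (Fin j → ℂ) →ₗ[ℂ] W12 xm xp,
      Function.Injective f ∧ ∀ x, (robinExpr hx α βm βp (f x) (f x)).re
        ≤ t * ‖(f x : L2 xm xp)‖ ^ 2 := Iff.rfl

theorem mem_trialValues_dirichletForm (hx : xm < xp) (α : ℝ) (j : ℕ) (t : ℝ) :
    t ∈ (dirichletForm hx α).trialValues j ↔ ∃ f : (Fin j → ℂ) →ₗ[ℂ] W120 xm xp,
      Function.Injective f ∧ ∀ x, (deltaExpr hx α (Submodule.inclusion W120_le_W12 (f x))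
        (Submodule.inclusion W120_le_W12 (f x))).re ≤ t * ‖(f x : L2 xm xp)‖ ^ 2 := Iff.rfl

theorem trialValues_dirichlet_subset_robin (hx : xm < xp) (α βm βp : ℝ) (j : ℕ) :
    (dirichletForm hx α).trialValues j ⊆ (robinForm hx α βm βp).trialValues j := by
  intro t ht
  rw [mem_trialValues_dirichletForm] at ht
  rw [mem_trialValues_robinForm]
  obtain ⟨f, hf, hft⟩ := ht
  refine ⟨(Submodule.inclusion W120_le_W12).comp f,
    (Submodule.inclusion_injective W120_le_W12).comp hf, fun x => ?_⟩
  refine le_trans (le_of_eq ?_) (hft x)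
  have hm : ∀ y (hy : y ∈ Icc xm xp), y ∉ Ioo xm xp →
      eval hx y hy (Submodule.inclusion W120_le_W12 (f x)) = 0 := fun y hy hy' =>
    eval_eq_zero_of_mem_W120 hx _ (f x).2 hy hy'
  rw [LinearMap.comp_apply, robinExpr_self_re, hm xm _ (by simp), hm xp _ (by simp)]
  simp

/-- Trial spaces of the Robin form with large parameters yield trial spaces of the Dirichlet
form. -/
theorem exists_dirichlet_trialValue (hx : xm < xp) (α c : ℝ)
    (hc : ∀ u : W12 xm xp, 0 ≤ deltaQuad hx α c u) {δ : ℝ} (hδ : 0 < δ) (hδ1 : δ < 1) (s : ℝ) :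
    ∃ B : ℝ, ∀ βm βp : ℝ, B ≤ min βm βp → ∀ j : ℕ, ∀ t ≤ s,
      t ∈ (robinForm hx α βm βp).trialValues j → 0 ≤ t + c →
      (1 + δ) ^ 2 / (1 - δ) * (t + c) - c ∈ (dirichletForm hx α).trialValues j := by
  obtain ⟨R, C, hC, hR⟩ := exists_boundary_correction hx α c hc
  set m := 1 + 1 / δ with hm
  have hmpos : 0 < m := by positivity
  -- The three thresholds make B positive, let the boundary energy dominate the correction in the
  -- form (m C ≤ B/2), and make the correction at most δ‖u‖² in the norm (2 m C (s + c) ≤ B δ).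
  refine ⟨max 1 (max (2 * (m * C)) (2 * (m * C) * (s + c) / δ)), fun βm βp hB j t hts ht htc => ?_⟩
  set B := min βm βp with hBdef
  have hB1 : 1 ≤ B := (le_max_left _ _).trans hB
  have hB2 : 2 * (m * C) ≤ B := (le_max_left _ _).trans ((le_max_right _ _).trans hB)
  have hB3 : 2 * (m * C) * (s + c) ≤ B * δ := by
    have : 2 * (m * C) * (s + c) / δ ≤ B := (le_max_right _ _).trans ((le_max_right _ _).trans hB)
    rwa [div_le_iff₀ hδ] at this
  have hB0 : 0 < B := by linarith
  rw [mem_trialValues_robinForm] at ht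
  rw [mem_trialValues_dirichletForm]
  obtain ⟨f, hf, hft⟩ := ht
  have key : ∀ u : W12 xm xp,
      (robinExpr hx α βm βp u u).re ≤ t * ‖(u : L2 xm xp)‖ ^ 2 →
      (1 - δ) * ‖(u : L2 xm xp)‖ ^ 2 ≤ (1 + δ) * ‖((u - R u : W12 xm xp) : L2 xm xp)‖ ^ 2 ∧
      deltaQuad hx α c (u - R u) ≤ (1 + δ) * ((t + c) * ‖(u : L2 xm xp)‖ ^ 2) := by
    intro u hu
    obtain ⟨-, hR1, hR2⟩ := hR u
    rw [robinExpr_self_re] at hu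
    set zm := ‖eval hx xm (left_mem hx) u‖ ^ 2
    set zp := ‖eval hx xp (right_mem hx) u‖ ^ 2
    have hzm : 0 ≤ zm := by positivity
    have hzp : 0 ≤ zp := by positivity
    set S := zm + zp with hS
    have hS0 : 0 ≤ S := by positivity
    have hBS : B * S ≤ βm * zm + βp * zp := by
      rw [hS, mul_add]
      gcongr
      · exact min_le_left _ _
      · exact min_le_right _ _
    set q := deltaQuad hx α c with hq
    have hqu : q u = (deltaExpr hx α u u).re + c * ‖(u : L2 xm xp)‖ ^ 2 := rfl
    -- The decisive bound: as q u ≥ 0, it controls the boundary values S by 2 (t + c)‖u‖²/B.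
    have hqS : q u + B / 2 * S ≤ (t + c) * ‖(u : L2 xm xp)‖ ^ 2 := by linarith
    have hq0 : 0 ≤ q u := hc u
    have hu0 : 0 ≤ ‖(u : L2 xm xp)‖ ^ 2 := by positivity
    have hmCS : m * (C * S) ≤ B / 2 * S := by nlinarith
    constructor
    · have h1 : ‖(u : L2 xm xp)‖ ^ 2 ≤ (1 + δ) * ‖((u - R u : W12 xm xp) : L2 xm xp)‖ ^ 2
          + m * ‖(R u : L2 xm xp)‖ ^ 2 := by
        have h2 : ‖(u : L2 xm xp)‖
            ≤ ‖((u - R u : W12 xm xp) : L2 xm xp)‖ + ‖(R u : L2 xm xp)‖ := by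
          rw [Submodule.coe_sub]
          exact norm_le_norm_sub_add _ _
        set p := ‖((u - R u : W12 xm xp) : L2 xm xp)‖
        set r := ‖(R u : L2 xm xp)‖
        have h3 : (p + r) ^ 2 + 1 / δ * (δ * p - r) ^ 2 = (1 + δ) * p ^ 2 + m * r ^ 2 := by
          rw [hm]; field_simp; ring
        have h4 : 0 ≤ 1 / δ * (δ * p - r) ^ 2 := by positivity
        have h5 : ‖(u : L2 xm xp)‖ ^ 2 ≤ (p + r) ^ 2 := by gcongr
        linarith
      have h6 : m * ‖(R u : L2 xm xp)‖ ^ 2 ≤ m * (C * S) := by gcongr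
      have h7 : m * (C * S) ≤ δ * ‖(u : L2 xm xp)‖ ^ 2 := by
        have h8 : B * S ≤ 2 * ((s + c) * ‖(u : L2 xm xp)‖ ^ 2) := by
          have : (t + c) * ‖(u : L2 xm xp)‖ ^ 2 ≤ (s + c) * ‖(u : L2 xm xp)‖ ^ 2 := by gcongr
          linarith
        have h9 : B * (m * (C * S)) ≤ B * (δ * ‖(u : L2 xm xp)‖ ^ 2) := by
          calc B * (m * (C * S)) = m * C * (B * S) := by ring
            _ ≤ m * C * (2 * ((s + c) * ‖(u : L2 xm xp)‖ ^ 2)) := by gcongr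
            _ = 2 * (m * C) * (s + c) * ‖(u : L2 xm xp)‖ ^ 2 := by ring
            _ ≤ B * δ * ‖(u : L2 xm xp)‖ ^ 2 := by gcongr
            _ = _ := by ring
        exact le_of_mul_le_mul_left h9 hB0
      linarith
    · have hy := deltaQuad_young hx α c hδ.ne' u (R u)
      have hnn : 0 ≤ 1 / δ * deltaQuad hx α c ((δ : ℂ) • u + R u) :=
        mul_nonneg (by positivity) (hc _)
      rw [← hq, ← hm] at hy
      rw [← hq] at hnn
      have h6 : m * q (R u) ≤ m * (C * S) := by gcongr
      have h7 : (1 + δ) * (q u + B / 2 * S) ≤ (1 + δ) * ((t + c) * ‖(u : L2 xm xp)‖ ^ 2) := by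
        gcongr
      have h8 : 0 ≤ δ * (B / 2 * S) := by positivity
      nlinarith
  have hδ' : 0 < 1 - δ := by linarith
  let P : W12 xm xp →ₗ[ℂ] W120 xm xp :=
    ((W12 xm xp).subtype.comp (LinearMap.id - R)).codRestrict (W120 xm xp) fun u => (hR u).1
  have hP : ∀ u, Submodule.inclusion W120_le_W12 (P u) = u - R u := fun u => rfl
  -- The new trial space consists of the corrected functions u - R u. It is injectively parametrised
  -- because u = R u would give (1 - δ)‖u‖² ≤ 0; the two parts of `key` multiply to the factor (1 +
  -- δ)²/(1 - δ).
  refine ⟨P.comp f, ?_, fun x => ?_⟩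
  · rw [injective_iff_map_eq_zero]
    intro x hx0
    have h1 := (key (f x) (hft x)).1
    have h2 : f x - R (f x) = 0 := by
      rw [← hP]
      rw [LinearMap.comp_apply] at hx0
      rw [hx0, map_zero]
    rw [h2] at h1
    simp only [ZeroMemClass.coe_zero, norm_zero] at h1
    have h3 : ‖((f x : W12 xm xp) : L2 xm xp)‖ ^ 2 ≤ 0 := by
      by_contra h0
      nlinarith
    have h4 : ((f x : W12 xm xp) : L2 xm xp) = 0 := by
      rw [← norm_eq_zero]
      exact pow_eq_zero_iff (two_ne_zero) |>.1 (le_antisymm h3 (by positivity))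
    exact hf (by rw [map_zero]; exact Subtype.ext h4)
  · obtain ⟨h1, h2⟩ := key (f x) (hft x)
    rw [LinearMap.comp_apply, hP]
    change _ ≤ _ * ‖((f x - R (f x) : W12 xm xp) : L2 xm xp)‖ ^ 2
    rw [deltaQuad] at h2
    set n := ‖((f x - R (f x) : W12 xm xp) : L2 xm xp)‖ ^ 2
    have h3 : ‖((f x : W12 xm xp) : L2 xm xp)‖ ^ 2 ≤ (1 + δ) / (1 - δ) * n := by
      rw [div_mul_eq_mul_div, le_div_iff₀ hδ']
      linarith
    have h4 : (1 + δ) * ((t + c) * ‖((f x : W12 xm xp) : L2 xm xp)‖ ^ 2)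
        ≤ (1 + δ) * ((t + c) * ((1 + δ) / (1 - δ) * n)) := by gcongr
    have h5 : (1 + δ) * ((t + c) * ((1 + δ) / (1 - δ) * n))
        = (1 + δ) ^ 2 / (1 - δ) * (t + c) * n := by ring
    linarith

theorem tendsto_nthEigenvalue_robinOp (hx : xm < xp) (α : ℝ) {j : ℕ} (hj : 1 ≤ j) :
    Tendsto (fun β : ℝ × ℝ => nthEigenvalue (robinOp hx α β.1 β.2) j)
      (comap (fun β : ℝ × ℝ => min β.1 β.2) atTop)
      (𝓝 (nthEigenvalue (dirichletOp hx α) j)) := by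
  have hinf := not_finiteDimensional_L2 hx
  obtain ⟨cD, KD, hKD⟩ := exists_hasCompactResolvent_dirichletForm hx α
  have hD : nthEigenvalue (dirichletOp hx α) j = sInf ((dirichletForm hx α).trialValues j) :=
    hKD.nthEigenvalue_eq_sInf_trialValues hinf hj
  have hDne := hKD.trialValues_nonempty hinf j
  have hDbdd : BddBelow ((dirichletForm hx α).trialValues j) :=
    ⟨-cD, fun t ht => hKD.le_of_mem_trialValues hj ht⟩
  have hRob : ∀ β : ℝ × ℝ, nthEigenvalue (robinOp hx α β.1 β.2) j
      = sInf ((robinForm hx α β.1 β.2).trialValues j) := fun β => by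
    obtain ⟨c, K, hK⟩ := exists_hasCompactResolvent_robinForm hx α β.1 β.2
    exact hK.nthEigenvalue_eq_sInf_trialValues hinf hj
  have hRbdd : ∀ β : ℝ × ℝ, BddBelow ((robinForm hx α β.1 β.2).trialValues j) := fun β => by
    obtain ⟨c, K, hK⟩ := exists_hasCompactResolvent_robinForm hx α β.1 β.2
    exact ⟨-c, fun t ht => hK.le_of_mem_trialValues hj ht⟩
  simp only [hRob, hD]
  set L := sInf ((dirichletForm hx α).trialValues j) with hL
  rw [tendsto_order]
  refine ⟨fun l hl => ?_, fun l hl => Eventually.of_forall fun β => lt_of_le_of_lt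
    (csInf_le_csInf (hRbdd β) hDne (trialValues_dirichlet_subset_robin hx α β.1 β.2 j)) hl⟩
  -- Taking c from the form without boundary terms keeps it independent of β; it also serves every
  -- Robin form with nonnegative β.
  obtain ⟨c, hc⟩ := exists_coercive hx α 0 0
  have hc' : ∀ u : W12 xm xp, 0 ≤ deltaQuad hx α c u := by
    intro u
    have h1 := hc u
    rw [robinExpr_zero] at h1
    exact le_trans (by positivity) h1
  set m := (l + L) / 2 with hm
  have hmL : m < L := by rw [hm]; linarith
  have hlim : Tendsto (fun δ : ℝ => (1 + δ) ^ 2 / (1 - δ) * (m + c) - c) (𝓝[>] 0) (𝓝 m) := by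
    have h1 : ContinuousAt (fun δ : ℝ => (1 + δ) ^ 2 / (1 - δ) * (m + c) - c) 0 := by
      refine ContinuousAt.sub (ContinuousAt.mul (ContinuousAt.div ?_ ?_ (by norm_num)) ?_) ?_ <;>
        fun_prop
    have h2 := h1.tendsto.mono_left (nhdsWithin_le_nhds (s := Ioi 0))
    simpa using h2
  -- With m strictly between l and L, δ is chosen so that the distorted bound still lies below L. A
  -- Robin trial value below m would then yield a Dirichlet trial value below the infimum L.
  obtain ⟨δ, hδL, hδ, hδ1⟩ := ((hlim.eventually (gt_mem_nhds hmL)).and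
    (Ioo_mem_nhdsGT (zero_lt_one' ℝ))).exists
  obtain ⟨B, hB⟩ := exists_dirichlet_trialValue hx α c hc' hδ hδ1 m
  -- The bound by 0 makes the boundary terms nonnegative, which forces t + c ≥ 0 for every trial
  -- value t.
  filter_upwards [tendsto_comap.eventually (eventually_ge_atTop (max B 0))] with β hβ
  refine lt_of_lt_of_le (by rw [hm]; linarith : l < m) (le_csInf
    (hDne.mono (trialValues_dirichlet_subset_robin hx α β.1 β.2 j)) fun t ht => ?_)
  by_contra hlt
  have htm : t ≤ m := le_of_not_ge hlt
  have htc : 0 ≤ t + c := by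
    rw [mem_trialValues_robinForm] at ht
    obtain ⟨f, hf, hft⟩ := ht
    have : Nonempty (Fin j) := ⟨⟨0, hj⟩⟩
    obtain ⟨x, hx0⟩ := exists_ne (0 : Fin j → ℂ)
    have hfx : ((f x : W12 xm xp) : L2 xm xp) ≠ 0 := fun h0 => hx0 (hf (by
      rw [map_zero]; exact Subtype.ext h0))
    have h1 : 0 < ‖((f x : W12 xm xp) : L2 xm xp)‖ ^ 2 := by positivity
    have h2 := hft x
    have h3 := hc' (f x)
    rw [deltaQuad] at h3
    rw [robinExpr_self_re] at h2
    have hβ0 : 0 ≤ min β.1 β.2 := (le_max_right _ _).trans hβ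
    have h4 : 0 ≤ β.1 * ‖eval hx xm (left_mem hx) (f x)‖ ^ 2 :=
      mul_nonneg (hβ0.trans (min_le_left _ _)) (by positivity)
    have h5 : 0 ≤ β.2 * ‖eval hx xp (right_mem hx) (f x)‖ ^ 2 :=
      mul_nonneg (hβ0.trans (min_le_right _ _)) (by positivity)
    by_contra hneg
    nlinarith
  have h1 := csInf_le hDbdd (hB β.1 β.2 ((le_max_left _ _).trans hβ) j t htm ht htc)
  rw [← hL] at h1
  have hδ' : 0 < 1 - δ := by linarith
  have h2 : (1 + δ) ^ 2 / (1 - δ) * (t + c) ≤ (1 + δ) ^ 2 / (1 - δ) * (m + c) := by gcongr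
  linarith

end DeltaInteraction

theorem proposition2p6 (xm xp : ℝ) (hx : xm < xp) (α : ℝ) :
    (IsSelfAdjoint (DeltaInteraction.dirichletOp hx α) ∧
      UnboundedOp.HasPurelyDiscreteSpectrum (DeltaInteraction.dirichletOp hx α)) ∧
    (∀ βm βp : ℝ, IsSelfAdjoint (DeltaInteraction.robinOp hx α βm βp) ∧
      UnboundedOp.HasPurelyDiscreteSpectrum (DeltaInteraction.robinOp hx α βm βp)) ∧
    ∀ j : ℕ, 1 ≤ j →
      Filter.Tendsto
        (fun β : ℝ × ℝ =>
          UnboundedOp.nthEigenvalue (DeltaInteraction.robinOp hx α β.1 β.2) j)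
        (Filter.comap (fun β : ℝ × ℝ => min β.1 β.2) Filter.atTop)
        (nhds (UnboundedOp.nthEigenvalue (DeltaInteraction.dirichletOp hx α) j)) := by
  have hinf := IntervalSobolev.not_finiteDimensional_L2 hx
  refine ⟨?_, fun βm βp => ?_, fun j hj => DeltaInteraction.tendsto_nthEigenvalue_robinOp hx α hj⟩
  · obtain ⟨c, K, hK⟩ := DeltaInteraction.exists_hasCompactResolvent_dirichletForm hx α
    exact ⟨hK.isSelfAdjoint_operator, hK.hasPurelyDiscreteSpectrum hinf⟩
  · obtain ⟨c, K, hK⟩ := DeltaInteraction.exists_hasCompactResolvent_robinForm hx α βm βp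
    exact ⟨hK.isSelfAdjoint_operator, hK.hasPurelyDiscreteSpectrum hinf⟩
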